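/- Let $R$ be an integral domain with quotient field $K$. For subsets $A,B\subseteq K$ put $(A:B)=\{z\in K \mid zB\subseteq A\}$. Let $\widehat R=\{x\in K\mid \text{there is a non-zero } c\in R \text{ with } cx^n\in R \text{ for all } n\ge 1\}$ be the complete integral closure of $R$, and assume that $(R:\widehat R)\neq\{0\}$. Assume moreover that at least one of the following two conditions holds. * $R$ is weakly Krull: writing $\mathfrak X(R)$ for the set of minimal non-zero prime ideals of $R$, one has $R=\bigcap_{\mathfrak p\in\mathfrak X(R)}R_{\mathfrak p}$ (read as $K$ if $\mathfrak X(R)=\emptyset$), and for every non-zero $x\in R$ the set $\{\mathfrak p\in\mathfrak X(R)\mid x\notin R_{\mathfrak p}^{\times}\}$ is finite. * $R$ is a Mori domain: $R$ satisfies the ascending chain condition on divisorial ideals, that is, on ideals $I$ of $R$ with $I=(R:(R:I))$. Then $R$ is stable (every non-zero ideal $I$ of $R$ is invertible as an ideal of the overring $(I:I)$) if and only if every ideal of $R$ is $2$-generated (of the form $aR+bR$ with $a,b\in R$). If this holds, then $R$ is an order in a Dedekind domain, that is, there is a Dedekind domain $S$ that contains $R$ as a subring, has the same quotient field as $R$,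 and is a finitely generated $R$-module. (Here fields count as Dedekind domains.) -/

import Mathlib

open scoped nonZeroDivisors

namespace StableDomain

noncomputable section

/-! Throughout, `R` is a domain and `K` a quotient field of `R`. For `R`-submodules `A`, `B` of `K`,
`A / B` is Mathlib's colon module `{z ∈ K | z B ⊆ A}`, and `(1 : Submodule R K)` is the image
of `R` in `K`. -/

section

variable {R : Type*} [CommRing R] (K : Type*) [Field K] [Algebra R K]

/-- The ring `(I : I) = {z ∈ K | z I ⊆ I}` of an ideal `I` of `R`, as a subring of `K`
containing `R`. -/
def multiplierRing (I : Ideal R) : Subalgebra R K :=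
  Submodule.toSubalgebra
    (IsLocalization.coeSubmodule K I / IsLocalization.coeSubmodule K I)
    (Submodule.mem_div_iff_forall_mul_mem.2 fun y hy => by rwa [one_mul])
    (fun x y hx hy => Submodule.mem_div_iff_forall_mul_mem.2 fun z hz => by
      rw [mul_assoc]
      exact Submodule.mem_div_iff_forall_mul_mem.1 hx _
        (Submodule.mem_div_iff_forall_mul_mem.1 hy z hz))

/-- The ideal `I` of `R`, seen as an ideal of the overring `(I : I)`: it consists of those
elements of `(I : I)` that lie in (the image in `K` of) `I`. -/
def idealInMultiplierRing (I : Ideal R) : Ideal (multiplierRing K I) where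
  carrier := {x | (x : K) ∈ IsLocalization.coeSubmodule K I}
  zero_mem' := (IsLocalization.coeSubmodule K I).zero_mem
  add_mem' := fun hx hy => (IsLocalization.coeSubmodule K I).add_mem hx hy
  smul_mem' := fun c _ hx => Submodule.mem_div_iff_forall_mul_mem.1 c.2 _ hx

/-- `I` is stable if it is invertible as an ideal of the overring `(I : I)`. -/
def IsStableIdeal (I : Ideal R) : Prop :=
  IsUnit (idealInMultiplierRing K I : FractionalIdeal (multiplierRing K I)⁰ K)

/-- The localization `R_p` at a prime ideal `p`, as a subring of `K` containing `R`. -/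
def localizationAt [IsDomain R] [IsFractionRing R K] (p : Ideal R) [p.IsPrime] :
    Subalgebra R K :=
  Localization.subalgebra.ofField K p.primeCompl p.primeCompl_le_nonZeroDivisors

/-- `I` is divisorial if `I = (I⁻¹)⁻¹`, where `A⁻¹ = (R : A)`. -/
def IsDivisorial (I : Ideal R) : Prop :=
  (1 : Submodule R K) / (1 / IsLocalization.coeSubmodule K I) = IsLocalization.coeSubmodule K I

end

section

variable (R : Type*) [CommRing R] (K : Type*) [Field K] [Algebra R K]

/-- A domain is stable if every non-zero ideal is stable. -/
def IsStableDomain : Prop :=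
  ∀ I : Ideal R, I ≠ ⊥ → IsStableIdeal K I

/-- Every ideal of `R` is `2`-generated. -/
def AllIdealsTwoGenerated : Prop :=
  ∀ I : Ideal R, ∃ a ∈ I, ∃ b ∈ I, I = Ideal.span {a, b}

/-- The set `𝔛(R)` of prime ideals that are minimal among the non-zero prime ideals. -/
def minimalNonzeroPrimes : Set (PrimeSpectrum R) :=
  {p | Minimal (fun q : PrimeSpectrum R => q.asIdeal ≠ ⊥) p}

/-- `R` is weakly Krull if `R` is the intersection of the `R_p`, where `p` ranges over `𝔛(R)`, and
this intersection is of finite character: every non-zero `x ∈ R` is a non-unit in only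
finitely many of these rings `R_p`. (If `R` is a field, then `𝔛(R)` is empty
and the intersection is `K`.) -/
def IsWeaklyKrull [IsDomain R] [IsFractionRing R K] : Prop :=
  (⨅ p ∈ minimalNonzeroPrimes R, localizationAt K p.asIdeal) = (⊥ : Subalgebra R K) ∧
  ∀ x : R, x ≠ 0 →
    {p ∈ minimalNonzeroPrimes R |
      ¬ IsUnit (algebraMap R (localizationAt K p.asIdeal) x)}.Finite

/-- `R` is a Mori domain if it satisfies the ascending chain condition on divisorial ideals. -/
def IsMori : Prop :=
  WellFoundedGT {I : Ideal R // IsDivisorial K I}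

/-- The conductor `(R : R̂) = {z ∈ K | z R̂ ⊆ R}`, where `R̂` is the complete integral closure
of `R` in `K`. -/
def completeConductor : Submodule R K :=
  1 / Subalgebra.toSubmodule (completeIntegralClosure R K)

/-- `R` is an order in a Dedekind domain `S`: the ring `S ⊇ R` has the same quotient field `K` as
`R`, hence is taken inside `K`, and it is a finitely generated `R`-module. -/
def IsOrderInDedekindDomain : Prop :=
  ∃ S : Subalgebra R K, IsDedekindDomain S ∧ IsFractionRing S K ∧ Module.Finite R S

end

end

end StableDomain

/-! The domain `R` is compared with its complete integral closure `S`, which is a fractional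
ideal because the conductor is non-zero. Here `A / B` is the colon module `(A : B)` in `K`.

If all ideals are `2`-generated, the same holds over each ring `(I : I)`, so it suffices to see
that a fractional ideal `J` with `(J : J) = R` is invertible (`one_mem_mul_one_div`). Otherwise
`J (R : J)` lies in a maximal ideal `m`. If `m` is invertible, then `(R : J) = m (R : J)`,
against Nakayama's lemma. If not, then `E = (R : m) = (m : m)`, and `m J E = m J`. Since
`J / m J` has dimension two and `J E / m J` has dimension at most two, `J E = J`, that is,
`(R : m) = R`. This would make the generators of `m` so independent that `m²` needs three generators
(`one_div_coeSubmodule_ne_one`).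

Conversely let `R` be stable. The ring of multipliers of an ideal of `S` is `S`, so all ideals
of `S` are invertible and `S` is a Dedekind domain (`IsStableDomain.isDedekindDomain`). The
hypothesis that `R` is weakly Krull or Mori enters only in `isMaximal_comap`: non-zero primes of
`S` lie over maximal ideals of `R`. Consequently `m S ≠ S` for each maximal ideal `m`, and only
the primes of `S` over `m` matter locally at `m`.

The number of generators is controlled by the dimension of `S / m S` over `R / m`, which is at
most two (`IsStableDomain.exists_le_span_pair`). To see this one applies stability to an
`R`-submodule `N ⊆ S` of colength one which contains no ideals of `S` besides those in `m S`; it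
is the kernel of a linear functional on `S / m S` that does not vanish on the socle. Unless
`N = m S`, its ring of multipliers is `R + m S`, which has colength at most one in `S`. Hence locally
`S = R + R u`. A local computation with this quadratic extension shows that every ideal is
`2`-generated locally (`exists_le_span_pair`), and the Chinese remainder theorem glues local
generators to two global ones. Finally `S`, being a fractional ideal, is then `2`-generated as
an `R`-module. -/

namespace StableDomain

open Submodule IsLocalization

/-! ### Colon modules, stability and the complete integral closure -/

section Colon

variable {R K : Type*} [CommRing R] [Field K] [Algebra R K]

/-- A submodule `X` of `K` is stable if it is invertible over its ring of multipliers `X / X`,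
with inverse `(X / X) / X`; it suffices that the product of the two contains `1`. -/
def IsStableModule (X : Submodule R K) : Prop :=
  (1 : K) ∈ X * ((X / X) / X)

theorem mul_mem_of_mem_div {A B : Submodule R K} {x y : K} (hx : x ∈ A / B) (hy : y ∈ B) :
    x * y ∈ A :=
  mem_div_iff_forall_mul_mem.1 hx y hy

theorem mul_div_le (A B : Submodule R K) : B * (A / B) ≤ A :=
  Submodule.mul_le.2 fun x hx y hy => by rw [mul_comm]; exact mul_mem_of_mem_div hy hx

theorem colon_colon (A B C : Submodule R K) : A / B / C = A / (B * C) := by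
  refine le_antisymm (Submodule.le_div_iff_mul_le.2 ?_)
    (Submodule.le_div_iff_mul_le.2 (Submodule.le_div_iff_mul_le.2 ?_))
  · calc A / B / C * (B * C) = B * (C * (A / B / C)) := by ring
      _ ≤ B * (A / B) := mul_le_mul_right (mul_div_le _ _) _
      _ ≤ A := mul_div_le _ _
  · calc A / (B * C) * C * B = B * C * (A / (B * C)) := by ring
      _ ≤ A := mul_div_le _ _

theorem one_le_div_self (X : Submodule R K) : 1 ≤ X / X :=
  Submodule.le_div_iff_mul_le.2 (by rw [one_mul])

theorem mul_div_self (X : Submodule R K) : X * (X / X) = X :=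
  le_antisymm (mul_div_le _ _) <| by
    conv_lhs => rw [← mul_one X]
    exact mul_le_mul_right (one_le_div_self X) _

theorem div_self_mul_div_self (X : Submodule R K) : (X / X) * (X / X) = X / X :=
  le_antisymm
    (Submodule.le_div_iff_mul_le.2 <| by
      rw [mul_assoc, mul_comm _ X, mul_div_self, mul_comm, mul_div_self])
    (by conv_lhs => rw [← mul_one (X / X)]
        exact mul_le_mul_right (one_le_div_self X) _)

theorem IsStableModule.mul_eq {X : Submodule R K} (h : IsStableModule X) :
    X * ((X / X) / X) = X / X := by
  refine le_antisymm (mul_div_le _ _) ?_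
  calc X / X = 1 * (X / X) := (one_mul _).symm
    _ ≤ X * ((X / X) / X) * (X / X) := mul_le_mul_left (Submodule.one_le.2 h) _
    _ ≤ X * ((X / X) / X) := by
      rw [mul_assoc]
      refine mul_le_mul_right (Submodule.le_div_iff_mul_le.2 ?_) _
      rw [mul_assoc, mul_comm _ X, mul_div_self, mul_comm]
      exact mul_div_le _ _

/-- The ring of multipliers of a divisorial module, and more generally every colon module with
divisorial numerator, is divisorial. -/
theorem divisorial_div {A : Submodule R K} (hA : 1 / (1 / A) = A) (X : Submodule R K) :
    1 / (1 / (A / X)) = A / X := by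
  have h3 : ∀ C : Submodule R K, 1 / (1 / (1 / C)) = 1 / C := fun C => by
    refine le_antisymm ?_ ?_
    · refine Submodule.le_div_iff_mul_le.2 ?_
      calc 1 / (1 / (1 / C)) * C ≤ 1 / (1 / (1 / C)) * (1 / (1 / C)) :=
            mul_le_mul_right (Submodule.le_div_iff_mul_le.2 (mul_div_le 1 C)) _
        _ ≤ 1 := by rw [mul_comm]; exact mul_div_le _ _
    · exact Submodule.le_div_iff_mul_le.2 (mul_div_le 1 (1 / C))
  conv_lhs => rw [← hA, colon_colon]
  rw [h3, ← colon_colon, hA]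

theorem coeSubmodule_mul_eq_smul (m : Ideal R) (X : Submodule R K) :
    coeSubmodule K m * X = m • X := by
  refine le_antisymm (Submodule.mul_le.2 ?_) (Submodule.smul_le.2 ?_)
  · rintro _ ⟨r, hr, rfl⟩ x hx
    rw [Algebra.linearMap_apply, ← Algebra.smul_def]
    exact smul_mem_smul hr hx
  · intro r hr x hx
    rw [Algebra.smul_def]
    exact mul_mem_mul ⟨r, hr, rfl⟩ hx

theorem mem_idealInMultiplierRing {I : Ideal R} {x : multiplierRing K I} :
    x ∈ idealInMultiplierRing K I ↔ (x : K) ∈ coeSubmodule K I := Iff.rfl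

/-- A submodule of a fractional ideal is a fractional ideal. -/
theorem isFractional_of_le {X Y : Submodule R K} (h : X ≤ Y) (hY : IsFractional R⁰ Y) :
    IsFractional R⁰ X := by
  obtain ⟨c, hc, hcY⟩ := hY
  exact ⟨c, hc, fun b hb => hcY b (h hb)⟩

/-- A non-zero conductor contains a non-zero element of `R`, because `1` lies in the complete
integral closure. -/
theorem exists_ne_zero_mul_mem (h : completeConductor R K ≠ ⊥) :
    ∃ c : R, c ≠ 0 ∧ ∀ s ∈ completeIntegralClosure R K, ∃ r : R,
      algebraMap R K r = algebraMap R K c * s := by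
  obtain ⟨z, hz, hz0⟩ := (Submodule.ne_bot_iff _).1 h
  have h1 := mul_mem_of_mem_div hz (completeIntegralClosure R K).one_mem
  rw [mul_one] at h1
  obtain ⟨c, rfl⟩ := Submodule.mem_one.1 h1
  refine ⟨c, fun h0 => hz0 (by rw [h0, map_zero]), fun s hs => ?_⟩
  exact Submodule.mem_one.1 (mul_mem_of_mem_div hz hs)

theorem isFractional_completeIntegralClosure [IsDomain R]
    (h : completeConductor R K ≠ ⊥) :
    IsFractional R⁰ (Subalgebra.toSubmodule (completeIntegralClosure R K)) := by
  obtain ⟨c, hc0, hc⟩ := exists_ne_zero_mul_mem h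
  exact ⟨c, mem_nonZeroDivisors_of_ne_zero hc0, fun b hb => by
    obtain ⟨r, hr⟩ := hc b hb
    exact ⟨r, by rw [hr, Algebra.smul_def]⟩⟩

end Colon

section Exchange

variable {R M : Type*} [CommRing R] [AddCommGroup M] [Module R M] {m : Ideal R}

theorem mem_span_pair_sup_iff {N : Submodule R M} {a b x : M} :
    x ∈ span R {a, b} ⊔ N ↔ ∃ r s : R, ∃ n ∈ N, x = r • a + s • b + n := by
  rw [Submodule.mem_sup]
  constructor
  · rintro ⟨y, hy, n, hn, rfl⟩
    obtain ⟨r, s, rfl⟩ := mem_span_pair.1 hy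
    exact ⟨r, s, n, hn, rfl⟩
  · rintro ⟨r, s, n, hn, rfl⟩
    exact ⟨_, mem_span_pair.2 ⟨r, s, rfl⟩, n, hn, rfl⟩

/-- An element of `X` lies in a submodule containing `m X` as soon as a multiple by a scalar
outside the maximal ideal `m` does. -/
theorem mem_of_smul_mem_of_notMem (hm : m.IsMaximal) {X N : Submodule R M} (hN : m • X ≤ N)
    {x : M} (hx : x ∈ X) {r : R} (hr : r ∉ m) (h : r • x ∈ N) : x ∈ N := by
  obtain ⟨y, i, hi, hyi⟩ := hm.exists_inv hr
  have : x = y • r • x + i • x := by rw [smul_smul, ← add_smul, hyi, one_smul]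
  rw [this]
  exact N.add_mem (N.smul_mem _ h) (hN (smul_mem_smul hi hx))

/-- First exchange step in the `R ⧸ m`-vector space `X / N`: a generating pair can be chosen to
contain a given non-zero vector. -/
theorem exists_le_span_pair_sup (hm : m.IsMaximal) {X N : Submodule R M} (hN : m • X ≤ N)
    {a b x : M} (ha : a ∈ X) (hb : b ∈ X) (hX : X ≤ span R {a, b} ⊔ N) (hx : x ∈ X)
    (hxN : x ∉ N) : ∃ c ∈ X, X ≤ span R {x, c} ⊔ N := by
  obtain ⟨r, s, n, hn, hxe⟩ := mem_span_pair_sup_iff.1 (hX hx)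
  have key : ∀ {a b : M} {r s : R}, a ∈ X → b ∈ X → X ≤ span R {a, b} ⊔ N →
      x = r • a + s • b + n → r ∉ m → X ≤ span R {x, b} ⊔ N := by
    intro a b r s ha hb hX hxe hr
    have hN' : m • X ≤ span R {x, b} ⊔ N := hN.trans le_sup_right
    have hb' : b ∈ span R {x, b} ⊔ N := mem_sup_left (subset_span (by simp))
    have ha' : a ∈ span R {x, b} ⊔ N := by
      refine mem_of_smul_mem_of_notMem hm hN' ha hr ?_
      have : r • a = x - s • b - n := by rw [hxe]; abel
      rw [this]
      exact sub_mem (sub_mem (mem_sup_left (subset_span (by simp))) (smul_mem _ _ hb'))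
        (mem_sup_right hn)
    refine hX.trans (sup_le (span_le.2 ?_) le_sup_right)
    rintro _ (rfl | rfl)
    exacts [ha', hb']
  by_cases hr : r ∈ m
  · by_cases hs : s ∈ m
    · refine absurd ?_ hxN
      rw [hxe]
      exact N.add_mem (N.add_mem (hN (smul_mem_smul hr ha)) (hN (smul_mem_smul hs hb))) hn
    · exact ⟨a, ha, key (s := r) hb ha (by rwa [Set.pair_comm]) (by rw [hxe, add_comm (r • a)]) hs⟩
  · exact ⟨b, hb, key ha hb hX hxe hr⟩

/-- Second exchange step in the `R ⧸ m`-vector space `X / N`. -/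
theorem le_span_pair_sup_of_notMem (hm : m.IsMaximal) {X N : Submodule R M} (hN : m • X ≤ N)
    {x b y : M} (hb : b ∈ X) (hX : X ≤ span R {x, b} ⊔ N) (hy : y ∈ X)
    (hyN : y ∉ span R {x} ⊔ N) : X ≤ span R {x, y} ⊔ N := by
  obtain ⟨r, s, n, hn, hye⟩ := mem_span_pair_sup_iff.1 (hX hy)
  have hx' : x ∈ span R {x, y} ⊔ N := mem_sup_left (subset_span (by simp))
  have hs : s ∉ m := fun hs => hyN <| by
    rw [hye]
    exact add_mem (add_mem (mem_sup_left (smul_mem _ _ (subset_span (by simp))))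
      (mem_sup_right (hN (smul_mem_smul hs hb)))) (mem_sup_right hn)
  have hb' : b ∈ span R {x, y} ⊔ N := by
    refine mem_of_smul_mem_of_notMem hm (hN.trans le_sup_right) hb hs ?_
    have : s • b = y - r • x - n := by rw [hye]; abel
    rw [this]
    exact sub_mem (sub_mem (mem_sup_left (subset_span (by simp))) (smul_mem _ _ hx'))
      (mem_sup_right hn)
  refine hX.trans (sup_le (span_le.2 ?_) le_sup_right)
  rintro _ (rfl | rfl)
  exacts [hx', hb']

end Exchange

section Stable

variable {R K : Type*} [CommRing R] [IsDomain R] [Field K] [Algebra R K] [IsFractionRing R K]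

/-- A fractional ideal is, up to a non-zero factor, an ideal of the ring. -/
theorem exists_ideal_of_isFractional {X : Submodule R K} (hf : IsFractional R⁰ X) :
    ∃ c : K, c ≠ 0 ∧ ∃ I : Ideal R, ∀ y : K, y ∈ coeSubmodule K I ↔ ∃ x ∈ X, c * x = y := by
  obtain ⟨c, hc, hcX⟩ := hf
  refine ⟨algebraMap R K c, by simpa using nonZeroDivisors.ne_zero hc,
    (X.map (LinearMap.lsmul R K c)).comap (Algebra.linearMap R K), fun y => ⟨?_, ?_⟩⟩
  · rintro ⟨r, ⟨x, hx, hxr⟩, rfl⟩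
    exact ⟨x, hx, by simpa [Algebra.smul_def] using hxr⟩
  · rintro ⟨x, hx, rfl⟩
    obtain ⟨r, hr⟩ := hcX x hx
    refine ⟨r, ⟨x, hx, ?_⟩, ?_⟩
    · simpa using hr.symm
    · rw [Algebra.linearMap_apply, hr, Algebra.smul_def]

/-- In a stable domain every non-zero fractional ideal is stable, because stability is invariant
under scaling. -/
theorem IsStableDomain.isStableModule (h : IsStableDomain R K) {X : Submodule R K} (hX : X ≠ ⊥)
    (hf : IsFractional R⁰ X) : IsStableModule X := by
  obtain ⟨c, hc0, I, hmem⟩ := exists_ideal_of_isFractional hf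
  have hI : I ≠ ⊥ := by
    rintro hI
    obtain ⟨x, hx, hx0⟩ := X.ne_bot_iff.1 hX
    have := (hmem _).2 ⟨x, hx, rfl⟩
    rw [hI, coeSubmodule_bot] at this
    exact (mul_ne_zero hc0 hx0) this
  have hdiv : ∀ z : K, z ∈ coeSubmodule K I / coeSubmodule K I → z ∈ X / X := by
    intro z hz x hx
    obtain ⟨x', hx', he⟩ := (hmem _).1 (mul_mem_of_mem_div hz ((hmem _).2 ⟨x, hx, rfl⟩))
    have : z * x = x' := mul_left_cancel₀ hc0 (by rw [he]; ring)
    rwa [this]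
  obtain ⟨J, hJ⟩ := isUnit_iff_exists_inv.1 (h I hI)
  have h1 : (1 : K) ∈ ((idealInMultiplierRing K I : FractionalIdeal (multiplierRing K I)⁰ K) :
      Submodule (multiplierRing K I) K) * (J : Submodule (multiplierRing K I) K) := by
    rw [← FractionalIdeal.coe_mul, hJ]
    exact FractionalIdeal.one_mem_one _
  have key : ∀ w : K, w ∈ ((idealInMultiplierRing K I :
      FractionalIdeal (multiplierRing K I)⁰ K) :
      Submodule (multiplierRing K I) K) * (J : Submodule (multiplierRing K I) K) →
      w ∈ X * ((X / X) / X) := by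
    intro w hw
    refine Submodule.mul_induction_on hw ?_ fun x y => add_mem
    intro p hp q hq
    obtain ⟨⟨p', hp'E⟩, hp', rfl⟩ := (FractionalIdeal.mem_coeIdeal _).1 hp
    obtain ⟨x, hx, hxp⟩ := (hmem _).1 (mem_idealInMultiplierRing.1 hp')
    have : (algebraMap (multiplierRing K I) K ⟨p', hp'E⟩) * q = x * (c * q) := by
      rw [show algebraMap (multiplierRing K I) K ⟨p', hp'E⟩ = c * x from hxp.symm]
      ring
    rw [this]
    refine mul_mem_mul hx (mem_div_iff_forall_mul_mem.2 fun y hy => hdiv _ ?_)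
    have hy' := (hmem _).2 ⟨y, hy, rfl⟩
    -- an element of the ideal lies in the ring of multipliers
    have hyE : c * y ∈ multiplierRing K I := by
      obtain ⟨r, -, hr⟩ := hy'
      rw [← hr]
      exact (multiplierRing K I).algebraMap_mem r
    have : c * y * q ∈
        (1 : FractionalIdeal (multiplierRing K I)⁰ K) := by
      rw [← hJ]
      exact FractionalIdeal.mul_mem_mul
        ((FractionalIdeal.mem_coeIdeal _).2 ⟨⟨_, hyE⟩, hy', rfl⟩) hq
    obtain ⟨e, he⟩ := (FractionalIdeal.mem_one_iff _).1 this
    have he' : c * q * y = e := by rw [← show _ = (e : K) from he.symm]; ring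
    rw [he']
    exact e.2
  exact key 1 h1

/-- Rings of multipliers of fractional ideals consist of almost integral elements. -/
theorem div_self_le {X : Submodule R K} (hX : X ≠ ⊥) (hf : IsFractional R⁰ X) :
    X / X ≤ Subalgebra.toSubmodule (completeIntegralClosure R K) := by
  obtain ⟨c, hc, hcX⟩ := hf
  obtain ⟨w, hw, hw0⟩ := X.ne_bot_iff.1 hX
  obtain ⟨a, b, hb, rfl⟩ := IsFractionRing.div_surjective (A := R) w
  intro z hz
  have hpow : ∀ n : ℕ, z ^ n * (algebraMap R K a / algebraMap R K b) ∈ X := by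
    intro n
    induction n with
    | zero => simpa using hw
    | succ n ih => rw [pow_succ', mul_assoc]; exact mul_mem_of_mem_div hz ih
  have hb0 : algebraMap R K b ≠ 0 := by simpa using nonZeroDivisors.ne_zero hb
  have ha0 : a ≠ 0 := fun h => hw0 (by simp [h])
  refine ⟨c * a, mul_mem hc (mem_nonZeroDivisors_of_ne_zero ha0), fun n => ?_⟩
  obtain ⟨r, hr⟩ := hcX _ (hpow n)
  refine ⟨b * r, ?_⟩
  rw [map_mul, hr, Algebra.smul_def, Algebra.smul_def, map_mul]
  field_simp

/-- The complete integral closure of a stable domain with non-zero conductor is a Dedekind domain: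
the ring of multipliers of any of its ideals is the ring itself, so that stability says that
the ideal is invertible. -/
theorem IsStableDomain.isDedekindDomain (hs : IsStableDomain R K)
    (h : completeConductor R K ≠ ⊥) : IsDedekindDomain (completeIntegralClosure R K) := by
  set S := completeIntegralClosure R K with hS
  refine (isDedekindDomain_iff_mul_inv_cancel (K := K)).2 fun I hI => ?_
  have hmemI : ∀ s ∈ S, ∀ x ∈ I, s * x ∈ I := fun s hs x hx =>
    (I : Submodule S K).smul_mem ⟨s, hs⟩ hx
  let X : Submodule R K := (I : Submodule S K).restrictScalars R
  have hX : X ≠ ⊥ := by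
    intro h0
    apply hI
    ext x
    rw [FractionalIdeal.bot_eq_zero, FractionalIdeal.mem_zero_iff]
    exact ⟨fun hx => (Submodule.mem_bot R).1 (h0 ▸ hx), fun hx => hx ▸ I.zero_mem⟩
  have hXf : IsFractional R⁰ X := by
    obtain ⟨a, ha, haI⟩ := I.isFractional
    obtain ⟨c, hc0, hc⟩ := exists_ne_zero_mul_mem h
    have ha0 : a ≠ 0 := nonZeroDivisors.ne_zero ha
    obtain ⟨r, hr⟩ := hc a a.2
    have hr0 : r ≠ 0 := by
      rintro rfl
      rw [map_zero, zero_eq_mul] at hr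
      rcases hr with hr | hr
      · exact hc0 (by simpa using hr)
      · exact ha0 (Subtype.ext hr)
    refine ⟨r, mem_nonZeroDivisors_of_ne_zero hr0, fun b hb => ?_⟩
    obtain ⟨s, hs'⟩ := haI b hb
    obtain ⟨r', hr'⟩ := hc s s.2
    refine ⟨r', ?_⟩
    rw [hr', Algebra.smul_def, hr, mul_assoc]
    congr 1
  have hXX : X / X = Subalgebra.toSubmodule S := by
    refine le_antisymm (div_self_le hX hXf) fun s hs => ?_
    exact fun x hx => hmemI s hs x hx
  have h1 := hs.isStableModule hX hXf
  rw [IsStableModule, hXX] at h1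
  refine le_antisymm ?_ ?_
  · refine FractionalIdeal.mul_le.2 fun x hx y hy => ?_
    rw [mul_comm]
    exact (FractionalIdeal.mem_inv_iff hI).1 hy x hx
  · rw [FractionalIdeal.one_le]
    refine Submodule.mul_induction_on h1 (fun x hx y hy => ?_) fun x y hx hy => ?_
    · refine FractionalIdeal.mul_mem_mul hx ((FractionalIdeal.mem_inv_iff hI).2 fun z hz => ?_)
      exact (FractionalIdeal.mem_one_iff _).2 ⟨⟨_, mul_mem_of_mem_div hy hz⟩, rfl⟩
    · exact (I * I⁻¹).val.add_mem hx hy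

end Stable

/-! ### Two-generated ideals imply stability -/

section

variable {R K : Type*} [CommRing R] [Field K] [Algebra R K]

/-- The values of the form `α a² + β a b + γ b²` with `α, β, γ ∈ n`. -/
theorem exists_of_mem_mul_span_pair_sq (n : Ideal R) (a b : R) {x : R}
    (hx : x ∈ n • (Ideal.span {a, b} ^ 2 : Ideal R)) :
    ∃ α ∈ n, ∃ β ∈ n, ∃ γ ∈ n, x = α * a ^ 2 + β * (a * b) + γ * b ^ 2 := by
  refine Submodule.smul_induction_on hx (fun r hr y hy => ?_) ?_
  · rw [pow_two] at hy
    suffices h : ∃ α β γ : R, y = α * a ^ 2 + β * (a * b) + γ * b ^ 2 by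
      obtain ⟨α, β, γ, rfl⟩ := h
      exact ⟨r * α, n.mul_mem_right _ hr, r * β, n.mul_mem_right _ hr, r * γ,
        n.mul_mem_right _ hr, by rw [smul_eq_mul]; ring⟩
    refine Submodule.mul_induction_on hy (fun u hu v hv => ?_) ?_
    · obtain ⟨u₁, u₂, rfl⟩ := Ideal.mem_span_pair.1 hu
      obtain ⟨v₁, v₂, rfl⟩ := Ideal.mem_span_pair.1 hv
      exact ⟨u₁ * v₁, u₁ * v₂ + u₂ * v₁, u₂ * v₂, by ring⟩
    · rintro _ _ ⟨α, β, γ, rfl⟩ ⟨α', β', γ', rfl⟩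
      exact ⟨α + α', β + β', γ + γ', by ring⟩
  · rintro _ _ ⟨α, hα, β, hβ, γ, hγ, rfl⟩ ⟨α', hα', β', hβ', γ', hγ', rfl⟩
    exact ⟨α + α', add_mem hα hα', β + β', add_mem hβ hβ', γ + γ', add_mem hγ hγ', by ring⟩

theorem isFractional_of_le_one {X : Submodule R K} (h : X ≤ 1) : IsFractional R⁰ X :=
  ⟨1, one_mem _, fun b hb => by
    obtain ⟨r, hr⟩ := Submodule.mem_one.1 (h hb)
    exact ⟨r, by rw [hr, one_smul]⟩⟩

theorem coeSubmodule_le_one (I : Ideal R) : coeSubmodule K I ≤ 1 := by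
  rw [← coeSubmodule_top K]
  exact coeSubmodule_mono K le_top

/-- A submodule of `R` that does not contain `1` lies in a maximal ideal. -/
theorem exists_isMaximal_le_coeSubmodule {X : Submodule R K} (hX : X ≤ 1) (h1 : (1 : K) ∉ X) :
    ∃ m : Ideal R, m.IsMaximal ∧ X ≤ coeSubmodule K m := by
  obtain ⟨m, hm, hle⟩ := Ideal.exists_le_maximal (X.comap (Algebra.linearMap R K)) fun h => by
    have : (1 : R) ∈ X.comap (Algebra.linearMap R K) := h ▸ Submodule.mem_top
    exact h1 (by simpa using this)
  refine ⟨m, hm, fun x hx => ?_⟩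
  obtain ⟨r, rfl⟩ := Submodule.mem_one.1 (hX hx)
  exact ⟨r, hle hx, rfl⟩

theorem algebraMap_mem_coeSubmodule [IsFractionRing R K] {I : Ideal R} {r : R} :
    algebraMap R K r ∈ coeSubmodule K I ↔ r ∈ I := by
  constructor
  · rintro ⟨s, hs, h⟩
    rwa [← IsFractionRing.injective R K h]
  · exact fun h => ⟨r, h, rfl⟩

end

section TwoGenerated

variable {R K : Type*} [CommRing R] [IsDomain R] [Field K] [Algebra R K] [IsFractionRing R K]

/-- If `(R : m) = R` for a maximal ideal `m = (a, b)`, then `a, b` behave like a regular sequence,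
and `a², ab, b²` would be linearly independent modulo `m³`. -/
theorem one_div_coeSubmodule_ne_one (h : AllIdealsTwoGenerated R) {m : Ideal R}
    (hm : m.IsMaximal) (hm0 : m ≠ ⊥) : (1 : Submodule R K) / coeSubmodule K m ≠ 1 := by
  intro h1
  have hinj := IsFractionRing.injective R K
  obtain ⟨a, ha, b, hb, hab⟩ := h m
  have hdiv : ∀ z : K, (∃ r, algebraMap R K r = z * algebraMap R K a) →
      (∃ r, algebraMap R K r = z * algebraMap R K b) → ∃ r, algebraMap R K r = z := by
    rintro z ⟨r, hr⟩ ⟨s, hs⟩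
    suffices z ∈ (1 : Submodule R K) / coeSubmodule K m by
      rw [h1] at this
      exact Submodule.mem_one.1 this
    rintro _ ⟨x, hx, rfl⟩
    obtain ⟨p, q, rfl⟩ := Ideal.mem_span_pair.1 (hab ▸ hx : x ∈ Ideal.span {a, b})
    refine Submodule.mem_one.2 ⟨p * r + q * s, ?_⟩
    simp only [map_add, map_mul, hr, hs, Algebra.linearMap_apply]
    ring
  -- if `m` were principal, the inverse of a generator would lie in `(R : m) = R`
  have hne : ∀ {a b : R}, a ∈ m → b ∈ m → m = Ideal.span {a, b} →
      (∀ z : K, (∃ r, algebraMap R K r = z * algebraMap R K a) →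
      (∃ r, algebraMap R K r = z * algebraMap R K b) → ∃ r, algebraMap R K r = z) → a ≠ 0 := by
    rintro a b - hb hab hdiv rfl
    have hb0 : b ≠ 0 := by
      rintro rfl
      exact hm0 (by simp [hab])
    have hb0' : algebraMap R K b ≠ 0 := by simpa using hb0
    obtain ⟨r, hr⟩ := hdiv (algebraMap R K b)⁻¹ ⟨0, by simp⟩ ⟨1, by simp [hb0']⟩
    refine hm.ne_top ((Ideal.eq_top_iff_one _).2 ?_)
    have : (1 : R) = r * b := hinj (by rw [map_mul, hr, map_one, inv_mul_cancel₀ hb0'])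
    rw [this]
    exact m.mul_mem_left _ hb
  have ha0 : a ≠ 0 := hne ha hb hab hdiv
  have hb0 : b ≠ 0 := hne hb ha (by rw [hab, Set.pair_comm]) fun z h₁ h₂ => hdiv z h₂ h₁
  have ha0' : algebraMap R K a ≠ 0 := by simpa using ha0
  have hb0' : algebraMap R K b ≠ 0 := by simpa using hb0
  -- `a, b` is a regular sequence in either order
  have hreg : ∀ u v : R, u * a = v * b → ∃ z, u = b * z ∧ v = a * z := by
    intro u v huv
    have huv' := congrArg (algebraMap R K) huv
    rw [map_mul, map_mul] at huv'
    obtain ⟨z, hz⟩ := hdiv (algebraMap R K u / algebraMap R K b)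
      ⟨v, by field_simp; linear_combination -huv'⟩ ⟨u, by field_simp⟩
    rw [eq_div_iff hb0'] at hz
    have hu : u = b * z := hinj (by rw [map_mul, ← hz]; ring)
    exact ⟨z, hu, mul_right_cancel₀ hb0 (by rw [← huv, hu]; ring)⟩
  -- hence `a², ab, b²` satisfy no relation with a coefficient outside `m`
  have hrel : ∀ α β γ : R, α * a ^ 2 + β * (a * b) + γ * b ^ 2 = 0 → α ∈ m ∧ β ∈ m ∧ γ ∈ m := by
    intro α β γ he
    obtain ⟨z, -, hz⟩ := hreg (-(α * a + β * b)) (γ * b) (by linear_combination -he)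
    obtain ⟨w, hw, -⟩ := hreg (α * a) (-(β * a + γ * b)) (by linear_combination he)
    obtain ⟨z', -, hz'⟩ := hreg z γ (by linear_combination -hz)
    obtain ⟨w', hw', -⟩ := hreg α w (by linear_combination hw)
    have hβ : β = -(w' * a + z' * b) :=
      mul_left_cancel₀ (mul_ne_zero ha0 hb0) (by rw [hw', hz'] at he; linear_combination he)
    rw [hw', hz', hβ]
    exact ⟨m.mul_mem_right _ hb, m.neg_mem (add_mem (m.mul_mem_left _ ha) (m.mul_mem_left _ hb)),
      m.mul_mem_right _ ha⟩
  have hone : ∀ μ ∈ m, 1 - μ ∉ m := fun μ hμ h' =>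
    hm.ne_top ((Ideal.eq_top_iff_one _).2 (by simpa using add_mem h' hμ))
  have haa : a ^ 2 ∈ m ^ 2 := Ideal.pow_mem_pow ha 2
  have hbb : b ^ 2 ∈ m ^ 2 := Ideal.pow_mem_pow hb 2
  have hab' : a * b ∈ m ^ 2 := by rw [pow_two]; exact Ideal.mul_mem_mul ha hb
  have hN : ∀ x ∈ m • (m ^ 2 : Ideal R), ∃ α ∈ m, ∃ β ∈ m, ∃ γ ∈ m,
      x = α * a ^ 2 + β * (a * b) + γ * b ^ 2 := fun x hx =>
    exists_of_mem_mul_span_pair_sq m a b (hab ▸ hx)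
  obtain ⟨p, hp, q, hq, hpq⟩ := h (m ^ 2)
  have h₁ : a ^ 2 ∉ m • (m ^ 2 : Ideal R) := by
    intro hx
    obtain ⟨α, hα, β, hβ, γ, hγ, he⟩ := hN _ hx
    exact hone α hα (hrel (1 - α) (-β) (-γ) (by linear_combination he)).1
  obtain ⟨c, hc, hc'⟩ := exists_le_span_pair_sup hm le_rfl hp hq (hpq.le.trans le_sup_left) haa h₁
  have h₂ : a * b ∉ span R {a ^ 2} ⊔ m • (m ^ 2 : Ideal R) := by
    intro hx
    obtain ⟨y, hy, n, hn, hyn⟩ := Submodule.mem_sup.1 hx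
    obtain ⟨r, rfl⟩ := mem_span_singleton.1 hy
    obtain ⟨α, hα, β, hβ, γ, hγ, rfl⟩ := hN _ hn
    rw [smul_eq_mul] at hyn
    exact hone β hβ (hrel (-(r + α)) (1 - β) (-γ) (by linear_combination -hyn)).2.1
  obtain ⟨r, s, n, hn, he⟩ := mem_span_pair_sup_iff.1
    (le_span_pair_sup_of_notMem hm le_rfl hc hc' hab' h₂ hbb)
  obtain ⟨α, hα, β, hβ, γ, hγ, rfl⟩ := hN _ hn
  rw [smul_eq_mul, smul_eq_mul] at he
  exact hone γ hγ (hrel (-(r + α)) (-(s + β)) (1 - γ) (by linear_combination he)).2.2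

/-- Fractional ideals are `2`-generated as soon as ideals are. -/
theorem exists_eq_span_pair (h : AllIdealsTwoGenerated R) {X : Submodule R K}
    (hf : IsFractional R⁰ X) : ∃ a ∈ X, ∃ b ∈ X, X = span R {a, b} := by
  obtain ⟨c, hc0, I, hI⟩ := exists_ideal_of_isFractional hf
  obtain ⟨a, ha, b, hb, hab⟩ := h I
  obtain ⟨x, hx, hxa⟩ := (hI _).1 ⟨a, ha, rfl⟩
  obtain ⟨y, hy, hyb⟩ := (hI _).1 ⟨b, hb, rfl⟩
  refine ⟨x, hx, y, hy, le_antisymm (fun z hz => ?_) (span_le.2 ?_)⟩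
  · obtain ⟨r, hr, hrz⟩ := (hI _).2 ⟨z, hz, rfl⟩
    obtain ⟨p, q, rfl⟩ := Ideal.mem_span_pair.1 (hab ▸ hr : r ∈ Ideal.span {a, b})
    refine mem_span_pair.2 ⟨p, q, mul_left_cancel₀ hc0 ?_⟩
    rw [← hrz, Algebra.smul_def, Algebra.smul_def, Algebra.linearMap_apply, map_add, map_mul,
      map_mul]
    rw [Algebra.linearMap_apply] at hxa hyb
    rw [← hxa, ← hyb]
    ring
  · rintro _ (rfl | rfl)
    exacts [hx, hy]

theorem isFractional_div {X Y : Submodule R K} (hX : IsFractional R⁰ X) (hY : Y ≠ ⊥) :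
    IsFractional R⁰ (X / Y) := by
  obtain ⟨w, hw, hw0⟩ := Y.ne_bot_iff.1 hY
  obtain ⟨a, b, hb, rfl⟩ := IsFractionRing.div_surjective (A := R) w
  obtain ⟨c, hc, hcX⟩ := hX
  have hb0 : algebraMap R K b ≠ 0 := by simpa using nonZeroDivisors.ne_zero hb
  have ha0 : a ≠ 0 := fun h => hw0 (by simp [h])
  refine ⟨c * a, mul_mem hc (mem_nonZeroDivisors_of_ne_zero ha0), fun z hz => ?_⟩
  obtain ⟨r, hr⟩ := hcX _ (mul_mem_of_mem_div hz hw)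
  refine ⟨b * r, ?_⟩
  rw [map_mul, hr, Algebra.smul_def, Algebra.smul_def, map_mul]
  field_simp

/-- If all ideals of `R` are `2`-generated, then a non-zero fractional ideal with ring of
multipliers `R` is invertible. -/
theorem one_mem_mul_one_div (h : AllIdealsTwoGenerated R) {J : Submodule R K} (hJ : J ≠ ⊥)
    (hf : IsFractional R⁰ J) (hJJ : J / J = 1) : (1 : K) ∈ J * (1 / J) := by
  have hinj := IsFractionRing.injective R K
  by_contra hcon
  obtain ⟨m, hm, hle⟩ := exists_isMaximal_le_coeSubmodule (mul_div_le 1 J) hcon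
  set M := coeSubmodule K m with hM
  have hM1 : M ≤ 1 := coeSubmodule_le_one m
  have honem : (1 : R) ∉ m := fun h' => hm.ne_top ((Ideal.eq_top_iff_one _).2 h')
  obtain ⟨w, hw, hw0⟩ := J.ne_bot_iff.1 hJ
  -- a common denominator of `J` is a non-zero element of `(R : J)`
  obtain ⟨c, hc, hcJ⟩ := hf
  have hc0 : algebraMap R K c ≠ 0 := by simpa using nonZeroDivisors.ne_zero hc
  have hcJ' : algebraMap R K c ∈ 1 / J := fun y hy => by
    obtain ⟨r, hr⟩ := hcJ y hy
    exact Submodule.mem_one.2 ⟨r, by rw [hr, Algebra.smul_def]⟩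
  have hm0 : m ≠ ⊥ := by
    rintro rfl
    have := hle (mul_mem_mul hw hcJ')
    rw [hM, coeSubmodule_bot] at this
    exact (mul_ne_zero hw0 hc0) this
  have hMbot : M ≠ ⊥ := by
    obtain ⟨r, hr, hr0⟩ := m.ne_bot_iff.1 hm0
    exact M.ne_bot_iff.2 ⟨algebraMap R K r, ⟨r, hr, rfl⟩, by simpa using hr0⟩
  have hf : IsFractional R⁰ J := ⟨c, hc, hcJ⟩
  have hone : IsFractional R⁰ (1 : Submodule R K) := isFractional_of_le_one le_rfl
  have hfg : ∀ {X : Submodule R K}, IsFractional R⁰ X → X.FG := by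
    intro X hX
    obtain ⟨a, -, b, -, hab⟩ := exists_eq_span_pair h hX
    rw [hab]
    exact fg_span (by simp)
  have hsub : ∀ r : R, r - 1 ∈ m → r ∉ m := fun r hr hr' =>
    honem (by simpa using sub_mem hr' hr)
  by_cases hMinv : (1 : K) ∈ M * (1 / M)
  · -- if `m` is invertible, then `(R : J) = m (R : J)`, against Nakayama's lemma
    have h1 : 1 / J * (1 / M) ≤ 1 / J := by
      rw [Submodule.le_div_iff_mul_le]
      calc 1 / J * (1 / M) * J = J * (1 / J) * (1 / M) := by ring
        _ ≤ M * (1 / M) := mul_le_mul_left hle _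
        _ ≤ 1 := mul_div_le _ _
    have h2 : 1 / J ≤ m • (1 / J) := by
      calc 1 / J = 1 / J * 1 := (mul_one _).symm
        _ ≤ 1 / J * (M * (1 / M)) := mul_le_mul_right (Submodule.one_le.2 hMinv) _
        _ = M * (1 / J * (1 / M)) := by ring
        _ ≤ M * (1 / J) := mul_le_mul_right h1 _
        _ = m • (1 / J) := coeSubmodule_mul_eq_smul _ _
    obtain ⟨r, hr, hr'⟩ := exists_sub_one_mem_and_smul_eq_zero_of_fg_of_le_smul m _
      (hfg (isFractional_div hone hJ)) h2
    have h3 := hr' _ hcJ'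
    rw [Algebra.smul_def, mul_eq_zero, or_iff_left hc0, map_eq_zero_iff _ hinj] at h3
    exact hsub r hr (h3 ▸ m.zero_mem)
  · -- otherwise `(R : m) = (m : m)`, a proper overring of `R` that multiplies `J` into itself
    have hME : M * (1 / M) ≤ M := by
      intro x hx
      obtain ⟨r, rfl⟩ := Submodule.mem_one.1 (mul_div_le 1 M hx)
      by_contra hr
      obtain ⟨y, i, hi, hyi⟩ := hm.exists_inv fun h' => hr ⟨r, h', rfl⟩
      refine hMinv ?_
      rw [← map_one (algebraMap R K), ← hyi, map_add, map_mul, ← Algebra.smul_def]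
      refine add_mem (smul_mem _ _ hx) ?_
      have : algebraMap R K i ∈ M := ⟨i, hi, rfl⟩
      rw [← mul_one (algebraMap R K i)]
      exact mul_mem_mul this (Submodule.one_le.1 (Submodule.one_le_one_div.2 hM1))
    have hJE : J ≤ J * (1 / M) := by
      conv_lhs => rw [← mul_one J]
      exact mul_le_mul_right (Submodule.one_le_one_div.2 hM1) _
    have hN : m • (J * (1 / M)) ≤ m • J := by
      rw [← coeSubmodule_mul_eq_smul, ← coeSubmodule_mul_eq_smul]
      calc M * (J * (1 / M)) = J * (M * (1 / M)) := by ring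
        _ ≤ J * M := mul_le_mul_right hME _
        _ = M * J := mul_comm _ _
    have hnot : ∀ x ∈ J, ¬ J ≤ span R {x} ⊔ m • J := by
      intro x hx hJx
      obtain ⟨r, hr, hr'⟩ := exists_sub_one_mem_and_smul_le_of_fg_of_le_sup (hfg hf) le_rfl hJx
      have hr'' : ∀ y ∈ J, ∃ t : R, t • x = r • y := fun y hy =>
        mem_span_singleton.1 (hr' (smul_mem_pointwise_smul y r J hy))
      rcases eq_or_ne x 0 with rfl | hx0
      · obtain ⟨t, ht⟩ := hr'' w hw
        rw [smul_zero, Algebra.smul_def, zero_eq_mul, or_iff_left hw0,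
          map_eq_zero_iff _ hinj] at ht
        exact hsub r hr (ht ▸ m.zero_mem)
      · have : algebraMap R K r / x ∈ 1 / J := by
          intro y hy
          obtain ⟨t, ht⟩ := hr'' y hy
          refine Submodule.mem_one.2 ⟨t, ?_⟩
          rw [Algebra.smul_def, Algebra.smul_def] at ht
          field_simp
          exact ht
        have := hle (mul_mem_mul hx this)
        rw [mul_div_cancel₀ _ hx0] at this
        exact hsub r hr (algebraMap_mem_coeSubmodule.1 this)
    obtain ⟨x, hx, hxN⟩ := SetLike.not_le_iff_exists.1 (hnot 0 J.zero_mem)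
    rw [span_zero_singleton, bot_sup_eq] at hxN
    obtain ⟨y, hy, hyN⟩ := SetLike.not_le_iff_exists.1 (hnot x hx)
    obtain ⟨a, ha, b, hb, hab⟩ :=
      exists_eq_span_pair h (hf.mul (isFractional_div hone hMbot))
    obtain ⟨d, hd, hd'⟩ := exists_le_span_pair_sup hm hN ha hb (hab.le.trans le_sup_left)
      (hJE hx) hxN
    have hfin := le_span_pair_sup_of_notMem hm hN hd hd' (hJE hy) hyN
    have hle' : J * (1 / M) ≤ J := hfin.trans <| sup_le (span_le.2 (by
      rintro _ (rfl | rfl)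
      exacts [hx, hy])) smul_le_right
    refine one_div_coeSubmodule_ne_one (K := K) h hm hm0 (le_antisymm ?_ ?_)
    · exact (Submodule.le_div_iff_mul_le.2 (by rwa [mul_comm])).trans hJJ.le
    · exact Submodule.one_le_one_div.2 hM1

/-- Ideals of `(I : I)` are fractional ideals of `R`. -/
theorem allIdealsTwoGenerated_multiplierRing (h : AllIdealsTwoGenerated R) {I : Ideal R}
    (hI : I ≠ ⊥) : AllIdealsTwoGenerated (multiplierRing K I) := by
  intro Q
  let X : Submodule R K := (coeSubmodule K Q).restrictScalars R
  have hIbot : coeSubmodule K I ≠ ⊥ := fun h0 =>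
    hI (IsFractionRing.coeSubmodule_injective R K (by rw [h0, coeSubmodule_bot]))
  have hX : IsFractional R⁰ X := by
    refine isFractional_of_le (Y := coeSubmodule K I / coeSubmodule K I) ?_
      (isFractional_div (isFractional_of_le_one (coeSubmodule_le_one I)) hIbot)
    rintro _ ⟨q, -, rfl⟩
    exact q.2
  obtain ⟨_, ⟨a, ha, rfl⟩, _, ⟨b, hb, rfl⟩, hab⟩ := exists_eq_span_pair h hX
  refine ⟨a, ha, b, hb, le_antisymm (fun q hq => ?_) (Ideal.span_le.2 ?_)⟩
  · have : (q : K) ∈ X := ⟨q, hq, rfl⟩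
    rw [hab] at this
    obtain ⟨r, s, hrs⟩ := mem_span_pair.1 this
    refine Ideal.mem_span_pair.2 ⟨algebraMap R _ r, algebraMap R _ s, Subtype.ext ?_⟩
    rw [← hrs, Algebra.smul_def, Algebra.smul_def]
    rfl
  · rintro _ (rfl | rfl)
    exacts [ha, hb]

theorem AllIdealsTwoGenerated.isStableDomain (h : AllIdealsTwoGenerated R) :
    IsStableDomain R K := by
  intro I hI
  have hI' : idealInMultiplierRing K I ≠ ⊥ := by
    obtain ⟨r, hr, hr0⟩ := I.ne_bot_iff.1 hI
    refine (Submodule.ne_bot_iff _).2 ⟨algebraMap R _ r, ⟨r, hr, rfl⟩, fun h0 => hr0 ?_⟩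
    exact IsFractionRing.injective R K (by simpa using congrArg Subtype.val h0)
  have hbot : coeSubmodule K (idealInMultiplierRing K I) ≠ ⊥ := fun h0 =>
    hI' (IsFractionRing.coeSubmodule_injective _ K (by rw [h0, coeSubmodule_bot]))
  have h0 : (idealInMultiplierRing K I : FractionalIdeal (multiplierRing K I)⁰ K) ≠ 0 :=
    FractionalIdeal.coeIdeal_ne_zero.2 hI'
  have h1 := one_mem_mul_one_div (allIdealsTwoGenerated_multiplierRing (K := K) h hI) hbot
    (isFractional_of_le_one (coeSubmodule_le_one _)) <| by
      refine le_antisymm (fun z hz => ?_) (one_le_div_self _)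
      refine Submodule.mem_one.2 ⟨⟨z, fun y hy => ?_⟩, rfl⟩
      obtain ⟨r, hr, rfl⟩ := hy
      have hr' : algebraMap R K r ∈ coeSubmodule K (idealInMultiplierRing K I) :=
        ⟨algebraMap R _ r, ⟨r, hr, rfl⟩, rfl⟩
      obtain ⟨q, hq, hqe⟩ := mul_mem_of_mem_div hz hr'
      rw [Algebra.linearMap_apply, ← hqe]
      exact hq
  rw [IsStableIdeal, ← FractionalIdeal.mul_inv_cancel_iff_isUnit]
  refine le_antisymm ?_ ?_
  · refine FractionalIdeal.mul_le.2 fun x hx y hy => ?_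
    rw [mul_comm]
    exact (FractionalIdeal.mem_inv_iff h0).1 hy x hx
  · rw [FractionalIdeal.one_le]
    refine Submodule.mul_induction_on h1 (fun x hx y hy => ?_) fun x y hx hy => ?_
    · refine FractionalIdeal.mul_mem_mul hx ((FractionalIdeal.mem_inv_iff h0).2 fun z hz => ?_)
      exact (FractionalIdeal.mem_one_iff _).2 (Submodule.mem_one.1 (mul_mem_of_mem_div hy hz))
    · exact ((idealInMultiplierRing K I : FractionalIdeal (multiplierRing K I)⁰ K) *
        (idealInMultiplierRing K I : FractionalIdeal (multiplierRing K I)⁰ K)⁻¹).val.add_mem hx hy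

end TwoGenerated

/-! ### Primes of the complete integral closure lie over maximal ideals -/

section

variable {R K : Type*} [CommRing R] [Field K] [Algebra R K]

theorem div_mul_of_mul_eq_one {U V : Submodule R K} (h : U * V = 1) (A X : Submodule R K) :
    A / (U * X) = V * (A / X) := by
  refine le_antisymm ?_ (Submodule.le_div_iff_mul_le.2 ?_)
  · calc A / (U * X) = V * (U * (A / (U * X))) := by rw [← mul_assoc, mul_comm V, h, one_mul]
      _ ≤ V * (A / X) := mul_le_mul_right (Submodule.le_div_iff_mul_le.2 (by
          calc U * (A / (U * X)) * X = U * X * (A / (U * X)) := by ring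
            _ ≤ A := mul_div_le _ _)) _
  · calc V * (A / X) * (U * X) = U * V * (X * (A / X)) := by ring
      _ ≤ A := by rw [h, one_mul]; exact mul_div_le _ _

theorem coeSubmodule_ne_bot [IsFractionRing R K] {I : Ideal R} (hI : I ≠ ⊥) :
    coeSubmodule K I ≠ ⊥ := fun h0 =>
  hI (IsFractionRing.coeSubmodule_injective R K (by rw [h0, coeSubmodule_bot]))

end

section Dimension

variable {R K : Type*} [CommRing R] [IsDomain R] [Field K] [Algebra R K] [IsFractionRing R K]

/-- In a stable domain no maximal ideal `m` satisfies `(R : m) = R`; hence in a stable weakly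
Krull domain all maximal ideals have height one. -/
theorem isMaximal_of_isWeaklyKrull (hs : IsStableDomain R K) (hw : IsWeaklyKrull R K)
    {p : Ideal R} (hp : p.IsPrime) (hp0 : p ≠ ⊥) : p.IsMaximal := by
  obtain ⟨m, hm, hpm⟩ := Ideal.exists_le_maximal p hp.ne_top
  have hm0 : m ≠ ⊥ := fun h => hp0 (le_bot_iff.1 (h ▸ hpm))
  suffices hmin : (⟨m, hm.isPrime⟩ : PrimeSpectrum R) ∈ minimalNonzeroPrimes R by
    have : m ≤ p := hmin.2 (y := ⟨p, hp⟩) hp0 hpm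
    rwa [le_antisymm hpm this]
  by_contra hcon
  have h1 : (1 : Submodule R K) / coeSubmodule K m ≤ 1 := by
    intro z hz
    have hz' : z ∈ (⨅ p ∈ minimalNonzeroPrimes R, localizationAt K p.asIdeal :
        Subalgebra R K) := by
      simp only [Algebra.mem_iInf]
      intro q hq
      obtain ⟨s, hsm, hsq⟩ : ∃ s ∈ m, s ∉ q.asIdeal := by
        refine SetLike.not_le_iff_exists.1 fun hle => hcon ?_
        have : m = q.asIdeal := hm.eq_of_le q.2.ne_top hle
        have : (⟨m, hm.isPrime⟩ : PrimeSpectrum R) = q := PrimeSpectrum.ext this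
        rwa [this]
      obtain ⟨r, hr⟩ := Submodule.mem_one.1
        (mul_mem_of_mem_div hz (algebraMap_mem_coeSubmodule.2 hsm))
      have hs0 : algebraMap R K s ≠ 0 := by
        simpa using fun h : s = 0 => hsq (h ▸ q.asIdeal.zero_mem)
      have hz : z = algebraMap R K r * (algebraMap R K s)⁻¹ := by
        rw [hr, mul_assoc, mul_inv_cancel₀ hs0, mul_one]
      exact ⟨r, s, hsq, hz⟩
    rw [hw.1] at hz'
    obtain ⟨r, hr⟩ := Algebra.mem_bot.1 hz'
    exact Submodule.mem_one.2 ⟨r, hr⟩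
  have hM1 : coeSubmodule K m ≤ 1 := coeSubmodule_le_one m
  have hst := hs.isStableModule (coeSubmodule_ne_bot hm0) (isFractional_of_le_one hM1)
  have hMM : coeSubmodule K m / coeSubmodule K m = 1 :=
    le_antisymm (le_trans (Submodule.le_div_iff_mul_le.2
      ((mul_comm _ _).le.trans ((mul_div_le _ _).trans hM1))) h1) (one_le_div_self _)
  rw [IsStableModule, hMM] at hst
  have := mul_le_mul_right h1 (coeSubmodule K m) hst
  rw [mul_one, ← map_one (algebraMap R K), algebraMap_mem_coeSubmodule] at this
  exact hm.ne_top ((Ideal.eq_top_iff_one _).2 this)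

/-- In a Mori domain the divisorial fractional ideals contained in a given fractional ideal
satisfy the ascending chain condition: a common denominator moves them into the ring. -/
theorem IsMori.wellFoundedGT (h : IsMori R K) {W : Submodule R K} (hW : IsFractional R⁰ W) :
    WellFoundedGT {X : Submodule R K // 1 / (1 / X) = X ∧ X ≤ W} := by
  obtain ⟨c, hc, hcW⟩ := hW
  have hc0 : algebraMap R K c ≠ 0 := by simpa using nonZeroDivisors.ne_zero hc
  set U : Submodule R K := span R {algebraMap R K c} with hU
  set V : Submodule R K := span R {(algebraMap R K c)⁻¹} with hV
  have hUV : U * V = 1 := by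
    rw [hU, hV, span_mul_span, Set.singleton_mul_singleton, mul_inv_cancel₀ hc0, one_eq_span]
  have hUW : ∀ X ≤ W, U * X ≤ 1 := by
    intro X hX
    refine Submodule.mul_le.2 fun u hu x hx => ?_
    obtain ⟨r, rfl⟩ := mem_span_singleton.1 hu
    rw [smul_mul_assoc, ← Algebra.smul_def]
    obtain ⟨s, hs⟩ := hcW x (hX hx)
    exact smul_mem _ _ (Submodule.mem_one.2 ⟨s, hs⟩)
  have hco : ∀ X ≤ W, coeSubmodule K ((U * X).comap (Algebra.linearMap R K)) = U * X := by
    intro X hX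
    refine map_comap_eq_of_le fun x hx => ?_
    obtain ⟨r, hr⟩ := Submodule.mem_one.1 (hUW X hX hx)
    exact ⟨r, hr⟩
  have : WellFoundedGT {I : Ideal R // IsDivisorial K I} := h
  let f : {X : Submodule R K // 1 / (1 / X) = X ∧ X ≤ W} → {I : Ideal R // IsDivisorial K I} :=
    fun X => ⟨(U * X.1).comap (Algebra.linearMap R K), by
      rw [IsDivisorial, hco _ X.2.2, div_mul_of_mul_eq_one hUV,
        div_mul_of_mul_eq_one (by rw [mul_comm, hUV]), X.2.1]⟩
  refine StrictMono.wellFoundedGT (f := f) (strictMono_of_le_iff_le fun X Y => ?_)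
  rw [← Subtype.coe_le_coe, ← Subtype.coe_le_coe]
  refine ⟨fun hle => comap_mono (mul_le_mul_right hle _), fun hle => ?_⟩
  have h1 : U * X.1 ≤ U * Y.1 := by
    rw [← hco _ X.2.2, ← hco _ Y.2.2]
    exact coeSubmodule_mono K hle
  calc X.1 = V * (U * X.1) := by rw [← mul_assoc, mul_comm V, hUV, one_mul]
    _ ≤ V * (U * Y.1) := mul_le_mul_right h1 _
    _ = Y.1 := by rw [← mul_assoc, mul_comm V, hUV, one_mul]

/-- If `M` is an invertible proper ideal of an overring `T` and `p = M p ≠ 0`, then the modules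
`(T : Mⁿ)` form a strictly ascending chain in the fractional ideal `(T : p)`. -/
theorem IsMori.false_of_le_mul (h : IsMori R K) {T M p : Submodule R K} (hT1 : 1 ≤ T)
    (hTT : T * T = T) (hT : 1 / (1 / T) = T) (hTf : IsFractional R⁰ T) (hMT : M ≤ T)
    (hTM : T * M = M) (h1 : (1 : K) ∉ M) (hinv : M * (T / M) = T) (hp0 : p ≠ ⊥) (hpT : p ≤ T)
    (hp : p ≤ M * p) : False := by
  have hpow : ∀ n : ℕ, p ≤ M ^ n * p := by
    intro n
    induction n with
    | zero => rw [pow_zero, one_mul]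
    | succ n ih =>
      calc p ≤ M * p := hp
        _ ≤ M * (M ^ n * p) := mul_le_mul_right ih _
        _ = M ^ (n + 1) * p := by ring
  have hpow' : ∀ n : ℕ, p ≤ M ^ (n + 1) := fun n =>
    calc p ≤ M ^ (n + 1) * p := hpow _
      _ ≤ M ^ (n + 1) * T := mul_le_mul_right hpT _
      _ = M ^ n * (T * M) := by ring
      _ = M ^ (n + 1) := by rw [hTM, pow_succ]
  have hanti : ∀ n : ℕ, M ^ (n + 1 + 1) ≤ M ^ (n + 1) := fun n =>
    calc M ^ (n + 1 + 1) = M ^ n * (M * M) := by ring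
      _ ≤ M ^ n * (T * M) := mul_le_mul_right (mul_le_mul_left hMT _) _
      _ = M ^ (n + 1) := by rw [hTM, pow_succ]
  have hdiv : ∀ {A B : Submodule R K}, A ≤ B → T / B ≤ T / A := fun {A B} hAB =>
    Submodule.le_div_iff_mul_le.2 ((mul_le_mul_right hAB _).trans
      ((mul_comm _ _).le.trans (mul_div_le _ _)))
  have := h.wellFoundedGT (isFractional_div hTf hp0)
  -- the exponent starts at one, so that `Mⁿ⁺¹` is an ideal of `T`
  let U : ℕ →o {X : Submodule R K // 1 / (1 / X) = X ∧ X ≤ T / p} :=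
    ⟨fun n => ⟨T / M ^ (n + 1), divisorial_div hT _, hdiv (hpow' n)⟩,
      monotone_nat_of_le_succ fun n => hdiv (hanti n)⟩
  obtain ⟨n, hn⟩ := WellFoundedGT.monotone_chain_condition U
  have hU : T / M ^ (n + 1) = T / M ^ (n + 1 + 1) :=
    congrArg Subtype.val (hn (n + 1) (Nat.le_succ n))
  have hTpow : ∀ k : ℕ, T ^ (k + 1) = T := by
    intro k
    induction k with
    | zero => rw [zero_add, pow_one]
    | succ k ih => rw [pow_succ, ih, hTT]
  set V := T / M with hV
  have h2 : V ^ (n + 1 + 1) ≤ T / M ^ (n + 1) := by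
    rw [hU, Submodule.le_div_iff_mul_le, mul_comm, ← mul_pow, hinv, hTpow]
  have h3 : V ≤ T :=
    calc V = 1 * V := (one_mul V).symm
      _ ≤ T * V := mul_le_mul_left hT1 _
      _ = (M * V) ^ (n + 1) * V := by rw [hinv, hTpow]
      _ = M ^ (n + 1) * V ^ (n + 1 + 1) := by ring
      _ ≤ M ^ (n + 1) * (T / M ^ (n + 1)) := mul_le_mul_right h2 _
      _ ≤ T := mul_div_le _ _
  refine h1 (Submodule.one_le.1 ?_)
  calc 1 ≤ T := hT1
    _ = M * V := hinv.symm
    _ ≤ M * T := mul_le_mul_right h3 _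
    _ = M := by rw [mul_comm, hTM]

/-- In a stable Mori domain with complete integral closure `S`, every prime ideal `P` of `S`
meets `R` in a maximal ideal. Otherwise take a maximal divisorial overring `T ⊆ S` in which `P ∩ T`
is properly contained in a proper ideal `M`. Enlarging `M` to its divisorial hull and `T` to
`(M : M)`, one sees that `M` is invertible in `T`, so that `P ∩ T = M (P ∩ T)`. -/
theorem IsMori.le_of_inf_one_le (h : IsMori R K) (hs : IsStableDomain R K)
    (hc : completeConductor R K ≠ ⊥) {P : Submodule R K}
    (hSP : ∀ s ∈ completeIntegralClosure R K, ∀ x ∈ P, s * x ∈ P)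
    (hPprime : ∀ x ∈ completeIntegralClosure R K, ∀ y ∈ completeIntegralClosure R K,
      x * y ∈ P → x ∈ P ∨ y ∈ P)
    (hP0 : P ⊓ 1 ≠ ⊥) {M : Submodule R K} (hM : M ≤ 1) (hM1 : (1 : K) ∉ M) (hPM : P ⊓ 1 ≤ M) :
    M ≤ P := by
  set S := Subalgebra.toSubmodule (completeIntegralClosure R K) with hS
  have hSf : IsFractional R⁰ S := isFractional_completeIntegralClosure hc
  have := h.wellFoundedGT hSf
  let Bad : Set {X : Submodule R K // 1 / (1 / X) = X ∧ X ≤ S} :=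
    {T | 1 ≤ T.1 ∧ T.1 * T.1 = T.1 ∧ ∃ M : Submodule R K, T.1 * M = M ∧ M ≤ T.1 ∧
      (1 : K) ∉ M ∧ P ⊓ T.1 ≤ M ∧ ¬ M ≤ P}
  by_contra hcon
  have hne : Bad.Nonempty := by
    refine ⟨⟨1, ?_, ?_⟩, le_rfl, one_mul _, M, one_mul _, hM, hM1, hPM, hcon⟩
    · have h11 : (1 : Submodule R K) / 1 = 1 := by
        refine le_antisymm (fun x hx => ?_) (one_le_div_self 1)
        have := mul_mem_of_mem_div hx (Submodule.one_le.1 le_rfl)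
        rwa [mul_one] at this
      rw [h11, h11]
    · exact Submodule.one_le.2 (completeIntegralClosure R K).one_mem
  clear hcon hPM hM1 hM M
  obtain ⟨⟨T, hTd, hTS⟩, ⟨hT1, hTT, M, hTM, hMT, hM1, hPM, hMP⟩, hmax⟩ :=
    WellFounded.has_min (wellFounded_gt (α := {X : Submodule R K // 1 / (1 / X) = X ∧ X ≤ S}))
      Bad hne
  dsimp only at hT1 hTT hTM hMT hPM
  have hp0 : P ⊓ T ≠ ⊥ := fun h0 => hP0 (le_bot_iff.1 (h0 ▸ inf_le_inf_left P hT1))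
  have hstable : ∀ X : Submodule R K, P ⊓ T ≤ X → X ≤ T → X * (X / X / X) = X / X := by
    intro X hX hXT
    refine (hs.isStableModule (fun h0 => hp0 (le_bot_iff.1 (h0 ▸ hX)))
      (isFractional_of_le (hXT.trans hTS) hSf)).mul_eq
  -- `(T : M)` is larger than `T`, so that the divisorial hull of `M` is a proper ideal
  have hTM' : ¬ T / M ≤ T := by
    intro hle
    have hMM : M / M = T := le_antisymm
      ((Submodule.le_div_iff_mul_le.2 ((mul_comm _ _).le.trans ((mul_div_le _ _).trans hMT))).trans
        hle) (Submodule.le_div_iff_mul_le.2 hTM.le)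
    have h1 := hstable M hPM hMT
    rw [hMM] at h1
    refine hM1 (Submodule.one_le.1 ?_)
    calc 1 ≤ T := hT1
      _ = M * (T / M) := h1.symm
      _ ≤ M * T := mul_le_mul_right hle _
      _ = M := by rw [mul_comm, hTM]
  set N := T / (T / M) with hN
  have hMN : M ≤ N := Submodule.le_div_iff_mul_le.2 (mul_div_le _ _)
  have hNT : N ≤ T := by
    intro x hx
    have := mul_mem_of_mem_div hx (Submodule.one_mem_div.2 hMT)
    rwa [mul_one] at this
  have hTN : T * N = N := by
    refine le_antisymm (Submodule.le_div_iff_mul_le.2 ?_) ?_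
    · calc T * N * (T / M) = T * (T / M * N) := by ring
        _ ≤ T * T := mul_le_mul_right (mul_div_le _ _) _
        _ = T := hTT
    · conv_lhs => rw [← one_mul N]
      exact mul_le_mul_left hT1 _
  have hN1 : (1 : K) ∉ N := fun h1 => hTM' (Submodule.one_mem_div.1 h1)
  have hPN : P ⊓ T ≤ N := hPM.trans hMN
  have hNP : ¬ N ≤ P := fun hle => hMP (hMN.trans hle)
  have hN0 : N ≠ ⊥ := fun h0 => hp0 (le_bot_iff.1 (h0 ▸ hPN))
  have hNf : IsFractional R⁰ N := isFractional_of_le (hNT.trans hTS) hSf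
  have hTE : T ≤ N / N := Submodule.le_div_iff_mul_le.2 hTN.le
  have hES : N / N ≤ S := div_self_le hN0 hNf
  -- `(N : N)` is again a bad overring, hence equal to `T`
  have hbad : (⟨N / N, divisorial_div (divisorial_div hTd _) _, hES⟩ :
      {X : Submodule R K // 1 / (1 / X) = X ∧ X ≤ S}) ∈ Bad := by
    refine ⟨one_le_div_self N, div_self_mul_div_self N, P ⊓ (N / N) ⊔ N, ?_, ?_, ?_, le_sup_left,
      fun hle => hNP (le_sup_right.trans hle)⟩
    · refine le_antisymm (Submodule.mul_le.2 fun x hx y hy => ?_) ?_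
      · obtain ⟨u, hu, v, hv, rfl⟩ := Submodule.mem_sup.1 hy
        rw [mul_add]
        refine add_mem (mem_sup_left ⟨hSP x (hES hx) u hu.1, ?_⟩)
          (mem_sup_right (mul_mem_of_mem_div hx hv))
        have := mul_mem_mul hx hu.2
        rwa [div_self_mul_div_self] at this
      · conv_lhs => rw [← one_mul (_ ⊔ _)]
        exact mul_le_mul_left (one_le_div_self N) _
    · exact sup_le inf_le_right (hNT.trans hTE)
    · intro h1
      obtain ⟨u, hu, v, hv, huv⟩ := Submodule.mem_sup.1 h1
      refine hN1 ?_
      rw [← huv]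
      refine add_mem (hPN ⟨hu.1, ?_⟩) hv
      rw [show u = 1 - v by rw [← huv]; ring]
      exact sub_mem (Submodule.one_le.1 hT1) (hNT hv)
  have hE : N / N = T := by
    by_contra hne
    exact hmax _ hbad (lt_of_le_of_ne (show T ≤ N / N from hTE) fun he =>
      hne (congrArg Subtype.val he).symm)
  have hinv := hstable N hPN hNT
  rw [hE] at hinv
  have hTp : T * (P ⊓ T) = P ⊓ T := by
    refine le_antisymm (Submodule.mul_le.2 fun x hx y hy => ⟨hSP x (hTS hx) y hy.1, ?_⟩) ?_
    · have := mul_mem_mul hx hy.2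
      rwa [hTT] at this
    · conv_lhs => rw [← one_mul (P ⊓ T)]
      exact mul_le_mul_left hT1 _
  have hNq : N * (T / N * (P ⊓ T)) = P ⊓ T := by rw [← mul_assoc, hinv, hTp]
  have hqT : T / N * (P ⊓ T) ≤ T :=
    (mul_le_mul_right hPN _).trans ((mul_comm _ _).le.trans (mul_div_le _ _))
  have hqp : T / N * (P ⊓ T) ≤ P ⊓ T := by
    refine le_inf (fun y hy => ?_) hqT
    obtain ⟨a, ha, haP⟩ := SetLike.not_le_iff_exists.1 hNP
    have hay : a * y ∈ P ⊓ T := hNq ▸ mul_mem_mul ha hy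
    exact (hPprime a (hTS (hNT ha)) y (hTS (hqT hy)) hay.1).resolve_left haP
  refine h.false_of_le_mul hT1 hTT hTd (isFractional_of_le hTS hSf) hNT hTN hN1 hinv hp0
    inf_le_right ?_
  calc P ⊓ T = N * (T / N * (P ⊓ T)) := hNq.symm
    _ ≤ N * (P ⊓ T) := mul_le_mul_right hqp _

/-- Non-zero prime ideals of the complete integral closure lie over maximal ideals. For a valuation
domain `R` of rank two with `S` of rank one this fails, although `R` may be stable. -/
theorem isMaximal_comap (hs : IsStableDomain R K) (hc : completeConductor R K ≠ ⊥)
    (hR : IsWeaklyKrull R K ∨ IsMori R K) {P : Ideal (completeIntegralClosure R K)}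
    (hP : P.IsPrime) (hP0 : P ≠ ⊥) :
    (P.comap (algebraMap R (completeIntegralClosure R K))).IsMaximal := by
  obtain ⟨c, hc0, hcS⟩ := exists_ne_zero_mul_mem hc
  obtain ⟨x, hx, hx0⟩ := P.ne_bot_iff.1 hP0
  obtain ⟨r, hr⟩ := hcS x x.2
  have hrx : algebraMap R (completeIntegralClosure R K) r =
      algebraMap R (completeIntegralClosure R K) c * x := Subtype.ext hr
  have hrP : algebraMap R (completeIntegralClosure R K) r ∈ P := hrx ▸ P.mul_mem_left _ hx
  have hr0 : r ≠ 0 := by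
    rintro rfl
    rw [map_zero, zero_eq_mul] at hr
    rcases hr with hr | hr
    · exact hc0 (by simpa using hr)
    · exact hx0 (Subtype.ext hr)
  have hprime : (P.comap (algebraMap R (completeIntegralClosure R K))).IsPrime :=
    Ideal.comap_isPrime _ _
  rcases hR with hw | hm
  · refine isMaximal_of_isWeaklyKrull hs hw hprime ?_
    exact (Submodule.ne_bot_iff _).2 ⟨r, hrP, hr0⟩
  · obtain ⟨m, hmm, hle⟩ := Ideal.exists_le_maximal _ hprime.ne_top
    let P' : Submodule R K :=
      (P.restrictScalars R).map (completeIntegralClosure R K).val.toLinearMap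
    have hP' : ∀ y : (completeIntegralClosure R K), (y : K) ∈ P' ↔ y ∈ P := by
      intro y
      constructor
      · rintro ⟨z, hz, hzy⟩
        rwa [← Subtype.ext (show (z : K) = y from hzy)]
      · exact fun hy => ⟨y, hy, rfl⟩
    have hmP : coeSubmodule K m ≤ P' := by
      refine hm.le_of_inf_one_le hs hc (P := P') ?_ ?_ ?_ (coeSubmodule_le_one m) ?_ ?_
      · rintro s hs' _ ⟨y, hy, rfl⟩
        exact ⟨⟨s, hs'⟩ * y, P.mul_mem_left _ hy, rfl⟩
      · intro x hx y hy hxy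
        rcases hP.mem_or_mem ((hP' (⟨x, hx⟩ * ⟨y, hy⟩)).1 hxy) with h | h
        · exact Or.inl ((hP' _).2 h)
        · exact Or.inr ((hP' _).2 h)
      · refine (Submodule.ne_bot_iff _).2 ⟨algebraMap R K r,
          ⟨(hP' (algebraMap R (completeIntegralClosure R K) r)).2 hrP,
          Submodule.mem_one.2 ⟨r, rfl⟩⟩, by simpa using hr0⟩
      · rw [← map_one (algebraMap R K), algebraMap_mem_coeSubmodule]
        exact fun h1 => hmm.ne_top ((Ideal.eq_top_iff_one _).2 h1)
      · rintro y ⟨hyP, hy1⟩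
        obtain ⟨t, rfl⟩ := Submodule.mem_one.1 hy1
        exact algebraMap_mem_coeSubmodule.2
          (hle ((hP' (algebraMap R (completeIntegralClosure R K) t)).1 hyP))
    have : m ≤ P.comap (algebraMap R (completeIntegralClosure R K)) := fun t ht =>
      (hP' (algebraMap R (completeIntegralClosure R K) t)).1
        (hmP (algebraMap_mem_coeSubmodule.2 ht))
    rwa [le_antisymm hle this]

end Dimension

/-! ### Localizing at a maximal ideal by multipliers -/

section LocalConductor

variable {R S : Type*} [CommRing R] [CommRing S] [Algebra R S]

/-- Up to a factor outside the maximal ideal `m`, every non-zero ideal of `S` contains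
a power of `m`: only the primes of `S` over `m` matter locally at `m`. -/
theorem exists_mul_mem_of_mem_pow [IsDedekindDomain S]
    (hmax : ∀ P : Ideal S, P.IsPrime → P ≠ ⊥ → (P.comap (algebraMap R S)).IsMaximal)
    {m : Ideal R} (hm : m.IsMaximal) (J : Ideal S) (hJ : J ≠ ⊥) :
    ∃ s ∉ m, ∃ N : ℕ, ∀ x ∈ m ^ N, algebraMap R S (s * x) ∈ J := by
  have h1 : (1 : R) ∉ m := fun h => hm.ne_top ((Ideal.eq_top_iff_one _).2 h)
  induction J using UniqueFactorizationMonoid.induction_on_prime with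
  | h₁ => exact absurd rfl hJ
  | h₂ J hu =>
    rw [Ideal.isUnit_iff.1 hu]
    exact ⟨1, h1, 0, fun _ _ => Submodule.mem_top⟩
  | h₃ J P hJ0 hP ih =>
    obtain ⟨s, hs, N, hN⟩ := ih hJ0
    have hPm := hmax P (Ideal.isPrime_of_prime hP) hP.ne_zero
    by_cases hle : P.comap (algebraMap R S) ≤ m
    · refine ⟨s, hs, N + 1, fun x hx => ?_⟩
      rw [pow_succ'] at hx
      refine Submodule.mul_induction_on hx (fun a ha b hb => ?_) fun x y hx hy => ?_
      · rw [show s * (a * b) = a * (s * b) by ring, map_mul]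
        refine Ideal.mul_mem_mul ?_ (hN b hb)
        rw [← hPm.eq_of_le hm.ne_top hle] at ha
        exact ha
      · rw [mul_add, map_add]
        exact add_mem hx hy
    · obtain ⟨t, ht, htm⟩ := SetLike.not_le_iff_exists.1 hle
      refine ⟨t * s, fun h => (hm.isPrime.mem_or_mem h).elim htm hs, N, fun x hx => ?_⟩
      rw [mul_assoc, map_mul]
      exact Ideal.mul_mem_mul ht (hN x hx)

theorem mul_mem_of_mem_map {m : Ideal R} {J : Ideal S} {s : R} {N : ℕ}
    (h : ∀ x ∈ m ^ N, algebraMap R S (s * x) ∈ J) {y : S}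
    (hy : y ∈ m.map (algebraMap R S) ^ N) : algebraMap R S s * y ∈ J := by
  rw [← Ideal.map_pow] at hy
  refine Submodule.span_induction ?_ (by simp) (fun x y _ _ hx hy => ?_) (fun t x _ hx => ?_) hy
  · rintro _ ⟨x, hx, rfl⟩
    rw [← map_mul]
    exact h x hx
  · rw [mul_add]
    exact add_mem hx hy
  · rw [smul_eq_mul, mul_left_comm]
    exact J.mul_mem_left _ hx

/-- Since `m S = S` would imply `c S = m (c S) ⊆ m`, whereas `s ∈ c S` for some `s ∉ m`, maximal
ideals of `R` remain proper in `S`. -/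
theorem map_ne_top [IsDedekindDomain S] [FaithfulSMul R S]
    (hmax : ∀ P : Ideal S, P.IsPrime → P ≠ ⊥ → (P.comap (algebraMap R S)).IsMaximal)
    {c : R} (hc0 : c ≠ 0) (hc : ∀ σ : S, ∃ r : R, algebraMap R S r = algebraMap R S c * σ)
    {m : Ideal R} (hm : m.IsMaximal) : m.map (algebraMap R S) ≠ ⊤ := by
  intro htop
  have hinj := FaithfulSMul.algebraMap_injective R S
  have hc0' : algebraMap R S c ≠ 0 := (map_ne_zero_iff _ hinj).2 hc0
  obtain ⟨s, hs, N, hN⟩ := exists_mul_mem_of_mem_pow hmax hm (Ideal.span {algebraMap R S c})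
    (by simpa using hc0)
  have h1 : algebraMap R S s * 1 ∈ Ideal.span {algebraMap R S c} :=
    mul_mem_of_mem_map hN (by rw [htop, Ideal.top_pow]; trivial)
  rw [mul_one, Ideal.mem_span_singleton] at h1
  obtain ⟨σ, hσ⟩ := h1
  -- `c S = c m S = m (c S)` is contained in `m`
  have key : ∀ y ∈ m.map (algebraMap R S), ∀ t : S, ∃ r ∈ m,
      algebraMap R S r = algebraMap R S c * (t * y) := by
    intro y hy
    refine Submodule.span_induction ?_ (fun t => ⟨0, m.zero_mem, by simp⟩)
      (fun x y _ _ hx hy t => ?_) (fun u x _ hx t => ?_) hy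
    · rintro _ ⟨a, ha, rfl⟩ t
      obtain ⟨r, hr⟩ := hc t
      exact ⟨r * a, m.mul_mem_left _ ha, by rw [map_mul, hr]; ring⟩
    · obtain ⟨r, hr, hr'⟩ := hx t
      obtain ⟨q, hq, hq'⟩ := hy t
      exact ⟨r + q, add_mem hr hq, by rw [map_add, hr', hq']; ring⟩
    · obtain ⟨r, hr, hr'⟩ := hx (t * u)
      exact ⟨r, hr, by rw [hr', smul_eq_mul]; ring⟩
  obtain ⟨r, hr, hr'⟩ := key σ (by rw [htop]; trivial) 1
  rw [one_mul, ← hσ] at hr'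
  exact hs (hinj hr' ▸ hr)

theorem le_sup_pow_smul {M : Type*} [AddCommGroup M] [Module R M] {m : Ideal R}
    {X W : Submodule R M} (h : X ≤ W ⊔ m • X) (n : ℕ) : X ≤ W ⊔ m ^ n • X := by
  induction n with
  | zero => rw [pow_zero, one_smul]; exact le_sup_right
  | succ n ih =>
    calc X ≤ W ⊔ m • X := h
      _ ≤ W ⊔ m • (W ⊔ m ^ n • X) := sup_le_sup_left (smul_mono_right _ ih) _
      _ ≤ W ⊔ m ^ (n + 1) • X := by
        rw [Submodule.smul_sup, ← Submodule.smul_assoc, pow_succ', smul_eq_mul, ← sup_assoc]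
        exact sup_le_sup_right (sup_le le_rfl smul_le_right) _

theorem mem_smul_top_iff {m : Ideal R} {x : S} :
    x ∈ m • (⊤ : Submodule R S) ↔ x ∈ m.map (algebraMap R S) := by
  rw [Ideal.smul_top_eq_map, Submodule.restrictScalars_mem]

/-- If `S / m S` is generated by two elements over `R / m`, then at most two primes of `S` lie
over `m`. -/
theorem eq_or_eq_of_le_span_pair [IsDedekindDomain S] {m : Ideal R} (hm : m.IsMaximal) {u v : S}
    (hu : (⊤ : Submodule R S) ≤ span R {u, v} ⊔ m • ⊤) {P₁ P₂ P₃ : Ideal S}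
    (h₁ : P₁.IsMaximal) (h₂ : P₂.IsMaximal) (h₃ : P₃.IsMaximal)
    (hm₁ : m.map (algebraMap R S) ≤ P₁) (hm₂ : m.map (algebraMap R S) ≤ P₂)
    (hm₃ : m.map (algebraMap R S) ≤ P₃) (h₁₂ : P₁ ≠ P₂) : P₃ = P₁ ∨ P₃ = P₂ := by
  by_contra! hcon
  have hcop : ∀ {P Q T : Ideal S}, P.IsMaximal → Q.IsMaximal → T.IsMaximal → P ≠ Q → P ≠ T →
      ∃ e ∉ P, e ∈ Q ∧ e ∈ T := by
    intro P Q T hP hQ hT hQP hTP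
    by_contra! hcon
    have : Q * T ≤ P := fun e he => by
      by_contra h
      exact hcon e h (Ideal.mul_le_left he) (Ideal.mul_le_right he)
    rcases hP.isPrime.mul_le.1 this with h | h
    · exact hQP (hQ.eq_of_le hP.ne_top h).symm
    · exact hTP (hT.eq_of_le hP.ne_top h).symm
  obtain ⟨e, he₁, he₂, he₃⟩ := hcop h₁ h₂ h₃ h₁₂ hcon.1.symm
  obtain ⟨f, hf₂, hf₁, hf₃⟩ := hcop h₂ h₁ h₃ h₁₂.symm hcon.2.symm
  obtain ⟨d, hd, hd'⟩ := exists_le_span_pair_sup hm le_rfl (Submodule.mem_top (x := u))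
    (Submodule.mem_top (x := v)) hu (Submodule.mem_top (x := e))
    fun h => he₁ (hm₁ (mem_smul_top_iff.1 h))
  have hfin := le_span_pair_sup_of_notMem hm le_rfl hd hd' (Submodule.mem_top (x := f)) <| by
    intro h
    obtain ⟨y, hy, n, hn, hyn⟩ := Submodule.mem_sup.1 h
    obtain ⟨r, rfl⟩ := mem_span_singleton.1 hy
    refine hf₂ (hyn ▸ add_mem ?_ (hm₂ (mem_smul_top_iff.1 hn)))
    rw [Algebra.smul_def]
    exact P₂.mul_mem_left _ he₂
  obtain ⟨r, s, n, hn, h1⟩ := mem_span_pair_sup_iff.1 (hfin (Submodule.mem_top (x := 1)))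
  refine h₃.ne_top ((Ideal.eq_top_iff_one _).2 ?_)
  rw [h1, Algebra.smul_def, Algebra.smul_def]
  exact add_mem (add_mem (P₃.mul_mem_left _ he₃) (P₃.mul_mem_left _ hf₃))
    (hm₃ (mem_smul_top_iff.1 hn))

/-- Locally at `m`, the ideal `I S` is generated by an element of `I`. Such an element is found by
avoiding the at most two submodules `P I S`, where `P` is a prime of `S` over `m`. -/
theorem exists_local_generator [IsDedekindDomain S] [FaithfulSMul R S]
    (hmax : ∀ P : Ideal S, P.IsPrime → P ≠ ⊥ → (P.comap (algebraMap R S)).IsMaximal)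
    {m : Ideal R} (hm : m.IsMaximal) (hmtop : m.map (algebraMap R S) ≠ ⊤) {u v : S}
    (hu : (⊤ : Submodule R S) ≤ span R {u, v} ⊔ m • ⊤) {I : Ideal R} (hI : I ≠ ⊥) :
    ∃ z ∈ I, ∃ s ∉ m, ∀ i ∈ I, ∃ σ : S, algebraMap R S (s * i) = σ * algebraMap R S z := by
  have hinj := FaithfulSMul.algebraMap_injective R S
  set IS := I.map (algebraMap R S) with hIS
  have hIS0 : IS ≠ ⊥ := fun h => hI ((Ideal.map_eq_bot_iff_of_injective hinj).1 h)
  have hex : ∀ P : Ideal S, P.IsMaximal → ∃ x ∈ I, algebraMap R S x ∉ P * IS := by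
    intro P hP
    by_contra! hcon
    have : IS ≤ P * IS := Ideal.map_le_iff_le_comap.2 hcon
    have h1 : P * IS = 1 * IS := by rw [one_mul]; exact le_antisymm Ideal.mul_le_right this
    exact hP.ne_top (by rw [mul_right_cancel₀ hIS0 h1, Ideal.one_eq_top])
  obtain ⟨P₁, hP₁, hm₁⟩ := Ideal.exists_le_maximal _ hmtop
  have hz : ∃ z ∈ I, ∀ P : Ideal S, P.IsMaximal → m.map (algebraMap R S) ≤ P →
      algebraMap R S z ∉ P * IS := by
    obtain ⟨x₁, hx₁, hx₁'⟩ := hex P₁ hP₁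
    by_cases h2 : ∃ P₂ : Ideal S, P₂.IsMaximal ∧ m.map (algebraMap R S) ≤ P₂ ∧ P₁ ≠ P₂
    · obtain ⟨P₂, hP₂, hm₂, hne⟩ := h2
      obtain ⟨x₂, hx₂, hx₂'⟩ := hex P₂ hP₂
      have hred : ∀ z, algebraMap R S z ∉ P₁ * IS → algebraMap R S z ∉ P₂ * IS →
          ∀ P : Ideal S, P.IsMaximal → m.map (algebraMap R S) ≤ P →
          algebraMap R S z ∉ P * IS := by
        intro z h₁ h₂ P hP hmP
        rcases eq_or_eq_of_le_span_pair hm hu hP₁ hP₂ hP hm₁ hm₂ hmP hne with rfl | rfl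
        exacts [h₁, h₂]
      by_cases h₁ : algebraMap R S x₁ ∈ P₂ * IS
      · by_cases h₂ : algebraMap R S x₂ ∈ P₁ * IS
        · refine ⟨x₁ + x₂, add_mem hx₁ hx₂, hred _ (fun h => hx₁' ?_) fun h => hx₂' ?_⟩
          · rw [map_add] at h
            simpa using sub_mem h h₂
          · rw [map_add] at h
            simpa using sub_mem h h₁
        · exact ⟨x₂, hx₂, hred _ h₂ hx₂'⟩
      · exact ⟨x₁, hx₁, hred _ hx₁' h₁⟩
    · push Not at h2
      refine ⟨x₁, hx₁, fun P hP hmP => ?_⟩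
      rw [← h2 P hP hmP]
      exact hx₁'
  obtain ⟨z, hz, hzP⟩ := hz
  have hz0 : algebraMap R S z ≠ 0 := fun h => hzP P₁ hP₁ hm₁ (h ▸ Ideal.zero_mem _)
  obtain ⟨J, hJ⟩ : IS ∣ Ideal.span {algebraMap R S z} := by
    rw [Ideal.dvd_span_singleton]
    exact Ideal.mem_map_of_mem _ hz
  have hJ0 : J ≠ ⊥ := by
    rintro rfl
    rw [Ideal.mul_bot, Ideal.span_singleton_eq_bot] at hJ
    exact hz0 hJ
  obtain ⟨s, hs, N, hN⟩ := exists_mul_mem_of_mem_pow hmax hm J hJ0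
  have htop : J ⊔ m.map (algebraMap R S) = ⊤ := by
    by_contra hne
    obtain ⟨P, hP, hle⟩ := Ideal.exists_le_maximal _ hne
    refine hzP P hP (le_sup_right.trans hle) ?_
    have : algebraMap R S z ∈ IS * J := hJ ▸ Ideal.mem_span_singleton_self _
    rw [mul_comm P]
    exact Ideal.mul_mono_right (le_sup_left.trans hle) this
  have hsJ : algebraMap R S s ∈ J := by
    obtain ⟨x, hx, y, hy, hxy⟩ := Submodule.mem_sup.1
      ((Ideal.eq_top_iff_one _).1 (Ideal.sup_pow_eq_top' (n := N) htop))
    rw [← mul_one (algebraMap R S s), ← hxy, mul_add]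
    exact add_mem (J.mul_mem_left _ hx) (mul_mem_of_mem_map hN hy)
  refine ⟨z, hz, s, hs, fun i hi => ?_⟩
  have : algebraMap R S (s * i) ∈ Ideal.span {algebraMap R S z} := by
    rw [hJ, mul_comm s, map_mul]
    exact Ideal.mul_mem_mul (Ideal.mem_map_of_mem _ hi) hsJ
  obtain ⟨σ, hσ⟩ := Ideal.mem_span_singleton'.1 this
  exact ⟨σ, hσ.symm⟩

end LocalConductor

/-! ### Two generators, locally and globally -/

section LocalGenerators

variable {R S : Type*} [CommRing R] [CommRing S] [Algebra R S]

/-- The elements `r` of `R` with `r u ∈ R`. -/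
def denominatorIdeal (R : Type*) {S : Type*} [CommRing R] [CommRing S] [Algebra R S] (u : S) :
    Ideal R where
  carrier := {r | ∃ q : R, algebraMap R S q = algebraMap R S r * u}
  zero_mem' := ⟨0, by simp⟩
  add_mem' := by
    rintro a b ⟨p, hp⟩ ⟨q, hq⟩
    exact ⟨p + q, by rw [map_add, map_add, hp, hq, add_mul]⟩
  smul_mem' := by
    rintro a b ⟨q, hq⟩
    exact ⟨a * q, by rw [smul_eq_mul, map_mul, map_mul, hq, mul_assoc]⟩

theorem mem_denominatorIdeal {u : S} {r : R} :
    r ∈ denominatorIdeal R u ↔ ∃ q : R, algebraMap R S q = algebraMap R S r * u := Iff.rfl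

/-- Suppose that `m` is, locally at `m` and modulo the ideal `F`, generated by one element `y`, and
that `F` contains a power of `y` locally. Then locally every ideal containing `F` is generated by
one element modulo `F`, namely by a power of `y`. -/
theorem exists_local_generator_mod {m F : Ideal R} (hm : m.IsMaximal) {y s t : R} (hs : s ∉ m)
    (ht : t ∉ m) (hy : ∀ a ∈ m, ∃ ρ, t * a - ρ * y ∈ F) {N : ℕ} (hN : s * y ^ N ∈ F)
    {B : Ideal R} (hB : F ≤ B) : ∃ b₀ ∈ B, ∃ d ∉ m, ∀ b ∈ B, ∃ ρ, d * b - ρ * b₀ ∈ F := by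
  have hmul : ∀ {a b : R}, a ∉ m → b ∉ m → a * b ∉ m := fun ha hb h =>
    (hm.isPrime.mem_or_mem h).elim ha hb
  let Q : ℕ → Prop := fun n => ∃ d ∉ m, ∀ b ∈ B, ∃ ρ, d * b - ρ * y ^ n ∈ F
  have hQ0 : Q 0 := ⟨1, fun h => hm.ne_top ((Ideal.eq_top_iff_one _).2 h), fun b _ =>
    ⟨b, by simp⟩⟩
  by_cases hQN : Q N
  · obtain ⟨d, hd, hdB⟩ := hQN
    refine ⟨0, B.zero_mem, s * d, hmul hs hd, fun b hb => ⟨0, ?_⟩⟩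
    obtain ⟨ρ, hρ⟩ := hdB b hb
    have : s * d * b - 0 * 0 = s * (d * b - ρ * y ^ N) + ρ * (s * y ^ N) := by ring
    rw [this]
    exact add_mem (F.mul_mem_left _ hρ) (F.mul_mem_left _ hN)
  · -- the last exponent `n` for which `B ⊆ (yⁿ) + F` locally
    obtain ⟨n, ⟨d, hd, hdB⟩, hn⟩ : ∃ n, Q n ∧ ¬ Q (n + 1) := by
      by_contra! hcon
      exact hQN (Nat.rec hQ0 hcon N)
    obtain ⟨b, hb, ρ, hρ, hρm⟩ : ∃ b ∈ B, ∃ ρ, d * b - ρ * y ^ n ∈ F ∧ ρ ∉ m := by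
      by_contra! hcon
      refine hn ⟨t * d, hmul ht hd, fun b hb => ?_⟩
      obtain ⟨ρ, hρ⟩ := hdB b hb
      obtain ⟨ρ', hρ'⟩ := hy ρ (hcon b hb ρ hρ)
      refine ⟨ρ', ?_⟩
      have : t * d * b - ρ' * y ^ (n + 1) =
        t * (d * b - ρ * y ^ n) + y ^ n * (t * ρ - ρ' * y) := by ring
      rw [this]
      exact add_mem (F.mul_mem_left _ hρ) (F.mul_mem_left _ hρ')
    refine ⟨ρ * y ^ n, ?_, ρ * d, hmul hρm hd, fun b' hb' => ?_⟩
    · have := sub_mem (B.mul_mem_left d hb) (hB hρ)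
      rwa [sub_sub_cancel] at this
    · obtain ⟨ρ', hρ'⟩ := hdB b' hb'
      refine ⟨ρ', ?_⟩
      have : ρ * d * b' - ρ' * (ρ * y ^ n) = ρ * (d * b' - ρ' * y ^ n) := by ring
      rw [this]
      exact F.mul_mem_left _ hρ'

/-- The Chinese remainder theorem for the quotients `I / m I` with `m` in a finite set. -/
theorem exists_sub_mem_smul {Z : Set (Ideal R)} (hZ : Z.Finite) (hmax : ∀ m ∈ Z, m.IsMaximal)
    {I : Ideal R} (y : Ideal R → R) (hy : ∀ m ∈ Z, y m ∈ I) :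
    ∃ x ∈ I, ∀ m ∈ Z, x - y m ∈ m • I := by
  classical
  have : Finite Z := hZ
  have hex : ∀ n : Ideal R, ∃ e : R, ∀ m : Z, e - (if (m : Ideal R) = n then 1 else 0) ∈ m.1 :=
    fun n => Ideal.exists_forall_sub_mem_ideal (I := fun m : Z => m.1) (fun p q hpq =>
      Ideal.isCoprime_iff_sup_eq.2
      ((hmax p p.2).coprime_of_ne (hmax q q.2) fun h => hpq (Subtype.ext h))) _
  -- `e n` is congruent to `1` modulo `n` and to `0` modulo the other members of `Z`
  choose e he using hex
  refine ⟨∑ n ∈ hZ.toFinset, e n * y n,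
    sum_mem fun n hn => I.mul_mem_left _ (hy n (hZ.mem_toFinset.1 hn)), fun m hm => ?_⟩
  have hm' : m ∈ hZ.toFinset := hZ.mem_toFinset.2 hm
  have : ∑ n ∈ hZ.toFinset, e n * y n - y m =
      ∑ n ∈ hZ.toFinset, (e n - if m = n then 1 else 0) * y n := by
    simp only [sub_mul, Finset.sum_sub_distrib, ite_mul, one_mul, zero_mul]
    rw [Finset.sum_ite_eq, if_pos hm']
  rw [this]
  exact sum_mem fun n hn =>
    Submodule.smul_mem_smul (he n ⟨m, hm⟩) (hy n (hZ.mem_toFinset.1 hn))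

variable [IsDedekindDomain S] [FaithfulSMul R S]

/-- If `S = R + R u` locally at `m`, then ideals of `R` are `2`-generated locally at `m`: up to
scaling an ideal has the form `R + B u`, where `B` is an ideal containing `{r | r u ∈ R}`, and
modulo the latter `B` is principal. -/
theorem exists_le_span_pair (hmax : ∀ P : Ideal S, P.IsPrime → P ≠ ⊥ →
      (P.comap (algebraMap R S)).IsMaximal)
    {c : R} (hc0 : c ≠ 0) (hc : ∀ σ : S, ∃ r : R, algebraMap R S r = algebraMap R S c * σ)
    {m : Ideal R} (hm : m.IsMaximal) (hm0 : m ≠ ⊥) {u : S}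
    (hu : (⊤ : Submodule R S) ≤ span R {1, u} ⊔ m • ⊤) {I : Ideal R} (hI : I ≠ ⊥) :
    ∃ a ∈ I, ∃ b ∈ I, I ≤ span R {a, b} ⊔ m • I := by
  have hinj := FaithfulSMul.algebraMap_injective R S
  have hmul : ∀ {a b : R}, a ∉ m → b ∉ m → a * b ∉ m := fun ha hb h =>
    (hm.isPrime.mem_or_mem h).elim ha hb
  have hmtop := map_ne_top hmax hc0 hc hm
  obtain ⟨s, hs, N, hN⟩ := exists_mul_mem_of_mem_pow hmax hm (Ideal.span {algebraMap R S c})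
    (by simpa using hc0)
  have hsN : ∀ y ∈ m.map (algebraMap R S) ^ N, ∃ r : R,
      algebraMap R S r = algebraMap R S s * y := by
    intro y hy
    obtain ⟨σ, hσ⟩ := Ideal.mem_span_singleton'.1 (mul_mem_of_mem_map hN hy)
    obtain ⟨r, hr⟩ := hc σ
    exact ⟨r, by rw [hr, ← hσ, mul_comm]⟩
  -- locally `S = R + R u`
  have hsS : ∀ σ : S, ∃ p q : R,
      algebraMap R S s * σ = algebraMap R S p + algebraMap R S q * u := by
    intro σ
    obtain ⟨p, q, n, hn, hσ⟩ := mem_span_pair_sup_iff.1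
      (le_sup_pow_smul hu N (Submodule.mem_top (x := σ)))
    rw [mem_smul_top_iff, Ideal.map_pow] at hn
    obtain ⟨r, hr⟩ := hsN n hn
    refine ⟨s * p + r, s * q, ?_⟩
    rw [hσ, map_add, hr, map_mul, map_mul, Algebra.smul_def, Algebra.smul_def]
    ring
  obtain ⟨z, hz, j, hj, hjz⟩ := exists_local_generator hmax hm hmtop hu hI
  obtain ⟨y, hy, j', hj', hjy⟩ := exists_local_generator hmax hm hmtop hu hm0
  set F := denominatorIdeal R u with hF
  have hmod : ∀ a ∈ m, ∃ ρ, s * s * j' * a - ρ * y ∈ F := by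
    intro a ha
    obtain ⟨σ, hσ⟩ := hjy a ha
    obtain ⟨p, q, hpq⟩ := hsS σ
    obtain ⟨p', q', hpq'⟩ := hsS (u ^ 2)
    -- `s j' a - p y = q u y`, and its multiple by `s u` lies in `R` since `s u² ∈ R + R u`
    have hd : algebraMap R S (s * j' * a - p * y) = algebraMap R S q * u * algebraMap R S y := by
      rw [map_sub, mul_assoc s, map_mul _ s, hσ, ← mul_assoc, hpq, map_mul]
      ring
    refine ⟨s * p, mem_denominatorIdeal.2 ⟨q * y * p' + q' * (s * j' * a - p * y), ?_⟩⟩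
    rw [show s * s * j' * a - s * p * y = s * (s * j' * a - p * y) by ring, map_mul _ s, hd,
      map_add,
      map_mul _ q', hd, map_mul, map_mul]
    linear_combination -algebraMap R S q * algebraMap R S y * hpq'
  have hFN : s * y ^ N ∈ F := by
    obtain ⟨r, hr⟩ := hsN (algebraMap R S y ^ N * u)
      (Ideal.mul_mem_right _ _ (Ideal.pow_mem_pow (Ideal.mem_map_of_mem _ hy) N))
    exact mem_denominatorIdeal.2 ⟨r, by rw [hr, map_mul, map_pow, mul_assoc]⟩
  -- after dividing by `z` and locally at `m`, the ideal `I` becomes `R + B u`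
  let B : Ideal R :=
    { carrier := {r | ∃ i ∈ I, algebraMap R S i = algebraMap R S r * u * algebraMap R S z}
      zero_mem' := ⟨0, I.zero_mem, by simp⟩
      add_mem' := by
        rintro a b ⟨p, hp, hp'⟩ ⟨q, hq, hq'⟩
        exact ⟨p + q, add_mem hp hq, by rw [map_add, map_add, hp', hq']; ring⟩
      smul_mem' := by
        rintro a b ⟨q, hq, hq'⟩
        exact ⟨a * q, I.mul_mem_left _ hq, by rw [smul_eq_mul, map_mul, map_mul, hq']; ring⟩ }
  have hFB : F ≤ B := by
    rintro r ⟨q, hq⟩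
    exact ⟨q * z, I.mul_mem_left _ hz, by rw [map_mul, hq]⟩
  obtain ⟨b₀, ⟨i₀, hi₀, hi₀'⟩, d, hd, hdB⟩ :=
    exists_local_generator_mod hm hs (hmul (hmul hs hs) hj') hmod hFN hFB
  refine ⟨z, hz, i₀, hi₀, fun i hi => ?_⟩
  refine mem_of_smul_mem_of_notMem hm le_sup_right hi (hmul (hmul hd hs) hj) (mem_sup_left ?_)
  obtain ⟨σ, hσ⟩ := hjz i hi
  obtain ⟨p, q, hpq⟩ := hsS σ
  have hq : algebraMap R S (s * j * i - p * z) = algebraMap R S q * u * algebraMap R S z := by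
    rw [map_sub, mul_assoc s, map_mul _ s, hσ, ← mul_assoc, hpq, map_mul]
    ring
  have hqB : q ∈ B := ⟨s * j * i - p * z,
    sub_mem (I.mul_mem_left _ hi) (I.mul_mem_left _ hz), hq⟩
  obtain ⟨ρ, φ, hφ⟩ := hdB q hqB
  refine mem_span_pair.2 ⟨d * p + φ, ρ, hinj ?_⟩
  simp only [map_mul, map_sub] at hq hφ
  simp only [smul_eq_mul, map_mul, map_add, hφ, hi₀']
  linear_combination -algebraMap R S d * hq

/-- If the conductor is not contained in `m`, then ideals of `R` are principal locally at `m`. -/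
theorem exists_le_span_singleton (hmax : ∀ P : Ideal S, P.IsPrime → P ≠ ⊥ →
      (P.comap (algebraMap R S)).IsMaximal)
    {c : R} (hc0 : c ≠ 0) (hc : ∀ σ : S, ∃ r : R, algebraMap R S r = algebraMap R S c * σ)
    {m : Ideal R} (hm : m.IsMaximal) (hcm : c ∉ m) {u : S}
    (hu : (⊤ : Submodule R S) ≤ span R {1, u} ⊔ m • ⊤) {I : Ideal R} (hI : I ≠ ⊥) :
    ∃ a ∈ I, I ≤ span R {a} ⊔ m • I := by
  have hinj := FaithfulSMul.algebraMap_injective R S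
  obtain ⟨z, hz, j, hj, hjz⟩ :=
    exists_local_generator hmax hm (map_ne_top hmax hc0 hc hm) hu hI
  refine ⟨z, hz, fun i hi => mem_of_smul_mem_of_notMem hm le_sup_right hi (r := c * j)
    (fun h => (hm.isPrime.mem_or_mem h).elim hcm hj) (mem_sup_left ?_)⟩
  obtain ⟨σ, hσ⟩ := hjz i hi
  obtain ⟨r, hr⟩ := hc σ
  refine mem_span_singleton.2 ⟨r, hinj ?_⟩
  rw [smul_eq_mul, smul_eq_mul, map_mul, hr, mul_assoc c, map_mul _ c, hσ, mul_assoc]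

/-- A non-zero element of `R` lies in only finitely many maximal ideals. -/
theorem finite_setOf_isMaximal_mem (hmax : ∀ P : Ideal S, P.IsPrime → P ≠ ⊥ →
      (P.comap (algebraMap R S)).IsMaximal)
    {c : R} (hc0 : c ≠ 0) (hc : ∀ σ : S, ∃ r : R, algebraMap R S r = algebraMap R S c * σ)
    {x : R} (hx : x ≠ 0) : {m : Ideal R | m.IsMaximal ∧ x ∈ m}.Finite := by
  have hinj := FaithfulSMul.algebraMap_injective R S
  have hx' : algebraMap R S x ≠ 0 := (map_ne_zero_iff _ hinj).2 hx
  have hfin := Ideal.finite_factors (I := Ideal.span {algebraMap R S x}) (by simpa using hx)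
  refine (hfin.image fun v => v.asIdeal.comap (algebraMap R S)).subset ?_
  rintro m ⟨hm, hxm⟩
  obtain ⟨P, hP, hle⟩ := Ideal.exists_le_maximal _ (map_ne_top hmax hc0 hc hm)
  have hxP : algebraMap R S x ∈ P := hle (Ideal.mem_map_of_mem _ hxm)
  refine ⟨⟨P, hP.isPrime, fun h => hx' (by simpa [h] using hxP)⟩, ?_, ?_⟩
  · exact (Ideal.dvd_span_singleton).2 hxP
  · exact (hm.eq_of_le (Ideal.comap_ne_top _ hP.ne_top) (Ideal.map_le_iff_le_comap.1 hle)).symm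

/-- Local generators are glued to two global ones: `a` is a minimal generator at the finitely many
maximal ideals over the conductor, and `b` is a complementary generator at the finitely many
maximal ideals containing `a`. -/
theorem allIdealsTwoGenerated_of_forall_isMaximal [IsDomain R]
    (hmax : ∀ P : Ideal S, P.IsPrime → P ≠ ⊥ → (P.comap (algebraMap R S)).IsMaximal)
    {c : R} (hc0 : c ≠ 0) (hc : ∀ σ : S, ∃ r : R, algebraMap R S r = algebraMap R S c * σ)
    (hu : ∀ m : Ideal R, m.IsMaximal → m ≠ ⊥ →
      ∃ u : S, (⊤ : Submodule R S) ≤ span R {1, u} ⊔ m • ⊤) : AllIdealsTwoGenerated R := by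
  intro I
  rcases eq_or_ne I ⊥ with rfl | hI
  · exact ⟨0, zero_mem _, 0, zero_mem _, by simp⟩
  have hinj := FaithfulSMul.algebraMap_injective R S
  -- `I = m I` would give `m S = S`, since `I S` is invertible
  have hne : ∀ m : Ideal R, m.IsMaximal → ∃ y ∈ I, y ∉ m • I := by
    intro m hm
    by_contra! hcon
    have h1 : I = m * I := le_antisymm hcon Ideal.mul_le_right
    have h2 : 1 * I.map (algebraMap R S) = m.map (algebraMap R S) * I.map (algebraMap R S) := by
      rw [one_mul, ← Ideal.map_mul, ← h1]
    have h3 := mul_right_cancel₀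
      (fun h => hI ((Ideal.map_eq_bot_iff_of_injective hinj).1 h)) h2
    exact map_ne_top hmax hc0 hc hm (by rw [← h3, Ideal.one_eq_top])
  obtain ⟨a, ha, ha0, hac⟩ : ∃ a ∈ I, a ≠ 0 ∧ ∀ m : Ideal R, m.IsMaximal → c ∈ m → a ∉ m • I := by
    by_cases hZ : ∃ m : Ideal R, m.IsMaximal ∧ c ∈ m
    · choose! y hy hy' using hne
      obtain ⟨a, ha, ha'⟩ := exists_sub_mem_smul (finite_setOf_isMaximal_mem hmax hc0 hc hc0)
        (fun m hm => hm.1) y (fun m hm => hy m hm.1)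
      have key : ∀ m : Ideal R, m.IsMaximal → c ∈ m → a ∉ m • I := fun m hm hcm h =>
        hy' m hm (by simpa using sub_mem h (ha' m ⟨hm, hcm⟩))
      obtain ⟨m, hm, hcm⟩ := hZ
      exact ⟨a, ha, fun h => key m hm hcm (h ▸ zero_mem _), key⟩
    · obtain ⟨a, ha, ha0⟩ := I.ne_bot_iff.1 hI
      exact ⟨a, ha, ha0, fun m hm hcm => absurd ⟨m, hm, hcm⟩ hZ⟩
  have hb : ∀ m : Ideal R, m.IsMaximal ∧ a ∈ m → ∃ b ∈ I, I ≤ span R {a, b} ⊔ m • I := by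
    rintro m ⟨hm, ham⟩
    have hm0 : m ≠ ⊥ := (Submodule.ne_bot_iff _).2 ⟨a, ham, ha0⟩
    obtain ⟨u, hu⟩ := hu m hm hm0
    by_cases hcm : c ∈ m
    · obtain ⟨p, hp, q, hq, hpq⟩ := exists_le_span_pair hmax hc0 hc hm hm0 hu hI
      exact exists_le_span_pair_sup hm le_rfl hp hq hpq ha (hac m hm hcm)
    · obtain ⟨b, hb, hb'⟩ := exists_le_span_singleton hmax hc0 hc hm hcm hu hI
      exact ⟨b, hb, hb'.trans (sup_le_sup_right (span_mono (by simp)) _)⟩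
  choose! y hy hy' using hb
  obtain ⟨b, hb, hb'⟩ := exists_sub_mem_smul (finite_setOf_isMaximal_mem hmax hc0 hc ha0)
    (fun m hm => hm.1) y hy
  have hloc : ∀ m : Ideal R, m.IsMaximal → a ∈ m → I ≤ span R {a, b} ⊔ m • I := by
    intro m hm ham
    refine (hy' m ⟨hm, ham⟩).trans (sup_le (span_le.2 ?_) le_sup_right)
    rintro _ (rfl | rfl)
    · exact mem_sup_left (subset_span (by simp))
    · rw [show y m = b - (b - y m) by ring]
      exact sub_mem (mem_sup_left (subset_span (by simp))) (mem_sup_right (hb' m ⟨hm, ham⟩))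
  have hle : span R {a, b} ≤ I := span_le.2 (by rintro _ (rfl | rfl); exacts [ha, hb])
  refine ⟨a, ha, b, hb, le_antisymm ?_ hle⟩
  -- the ideal of all `r` with `r I ⊆ (a, b)` lies in no maximal ideal
  let Q : Ideal R :=
    { carrier := {r | ∀ i ∈ I, r * i ∈ Ideal.span {a, b}}
      zero_mem' := fun i _ => by simp
      add_mem' := fun hx hy i hi => by
        rw [add_mul]
        exact add_mem (hx i hi) (hy i hi)
      smul_mem' := fun r x hx i hi => by
        rw [smul_eq_mul, mul_assoc]
        exact Ideal.mul_mem_left _ _ (hx i hi) }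
  suffices hQ : Q = ⊤ by
    intro i hi
    have := (Ideal.eq_top_iff_one Q).1 hQ i hi
    rwa [one_mul] at this
  by_contra hQ
  obtain ⟨m, hm, hQm⟩ := Ideal.exists_le_maximal _ hQ
  have haspan : a ∈ Ideal.span {a, b} := subset_span (by simp)
  have haQ : a ∈ Q := fun i _ => Ideal.mul_mem_right _ _ haspan
  obtain ⟨s, hs, N, hN⟩ := exists_mul_mem_of_mem_pow hmax hm (Ideal.span {algebraMap R S (c * a)})
    (by simpa using mul_ne_zero hc0 ha0)
  have hsa : ∀ x ∈ m ^ N, s * x ∈ Ideal.span {a, b} := by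
    intro x hx
    obtain ⟨σ, hσ⟩ := Ideal.mem_span_singleton'.1 (hN x hx)
    obtain ⟨r, hr⟩ := hc σ
    have : s * x = r * a := hinj (by rw [← hσ, map_mul, map_mul, hr]; ring)
    rw [this]
    exact Ideal.mul_mem_left _ _ haspan
  refine hs (hQm fun i hi => ?_)
  obtain ⟨p, hp, n, hn, rfl⟩ := Submodule.mem_sup.1
    (le_sup_pow_smul (hloc m hm (hQm haQ)) N hi)
  rw [mul_add]
  refine add_mem (Ideal.mul_mem_left _ _ hp) ?_
  refine Submodule.smul_induction_on hn (fun x hx k _ => ?_) fun x y hx hy => ?_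
  · rw [smul_eq_mul, ← mul_assoc]
    exact Ideal.mul_mem_right _ _ (hsa x hx)
  · rw [mul_add]
    exact add_mem hx hy

end LocalGenerators

/-! ### Stable domains: the fibres of the complete integral closure -/

section

/-- A linearly independent family of vectors avoids the kernel of some linear functional. -/
theorem exists_linearMap_eq_one {k V ι : Type*} [Field k] [AddCommGroup V] [Module k V]
    {v : ι → V} (hv : LinearIndependent k v) : ∃ φ : V →ₗ[k] k, ∀ i, φ (v i) = 1 := by
  obtain ⟨φ, hφ⟩ := LinearMap.exists_extend ((Module.Basis.span hv).constr k fun _ => (1 : k))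
  refine ⟨φ, fun i => ?_⟩
  have h1 : ((Module.Basis.span hv i : span k (Set.range v)) : V) = v i :=
    congrArg Subtype.val (Module.Basis.span_apply hv i)
  have h2 := (Module.Basis.span hv).constr_basis k (fun _ => (1 : k)) i
  rw [← hφ] at h2
  rwa [LinearMap.comp_apply, Submodule.subtype_apply, h1] at h2

variable {R S : Type*} [CommRing R] [CommRing S] [IsDedekindDomain S] [Algebra R S]

/-- There is an `R`-submodule `N` of `S` of colength one that contains no ideals of `S` besides
those in `m S`: the kernel of a linear functional that does not vanish on suitable socle elements
`v P` of `S / m S`, one for each prime `P` of `S` over `m`. -/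
theorem exists_colength_one {m : Ideal R} (hm : m.IsMaximal)
    (hm0 : m.map (algebraMap R S) ≠ ⊥) (hmtop : m.map (algebraMap R S) ≠ ⊤) :
    ∃ N : Submodule R S, m • (⊤ : Submodule R S) ≤ N ∧
      (∃ s : S, s ∉ N ∧ ∀ x, ∃ r : R, x - r • s ∈ N) ∧
      ∀ X : Ideal S, (∀ x ∈ X, x ∈ N) → X ≤ m.map (algebraMap R S) := by
  classical
  let _ := Ideal.Quotient.field m
  set M := m.map (algebraMap R S) with hM
  let ι := {P : Ideal S // P.IsMaximal ∧ M ≤ P}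
  -- the ideal `Q P = P⁻¹ m S`
  have hQ : ∀ P : ι, ∃ Q : Ideal S, M = P.1 * Q := fun P => Ideal.dvd_iff_le.2 P.2.2
  choose Q hQ using hQ
  have hQM : ∀ P : ι, ∃ v ∈ Q P, v ∉ M := by
    intro P
    by_contra! hcon
    have h1 : P.1 * Q P = 1 * Q P := by
      rw [one_mul]
      exact le_antisymm Ideal.mul_le_right ((show Q P ≤ M from hcon).trans (hQ P).le)
    have hQ0 : Q P ≠ 0 := fun h => hm0 (by rw [hQ P, h, mul_zero]; rfl)
    exact P.2.1.ne_top (by rw [mul_right_cancel₀ hQ0 h1, Ideal.one_eq_top])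
  choose v hv hvM using hQM
  have hPv : ∀ P : ι, ∀ x ∈ P.1, x * v P ∈ M := fun P x hx => by
    rw [hQ P]
    exact Ideal.mul_mem_mul hx (hv P)
  let V := S ⧸ (m • (⊤ : Submodule R S))
  have hmk : ∀ (r : R) (x : S), Ideal.Quotient.mk m r • (Submodule.Quotient.mk x : V) =
      Submodule.Quotient.mk (r • x) := fun r x => rfl
  have hli : LinearIndependent (R ⧸ m) (fun P : ι => (Submodule.Quotient.mk (v P) : V)) := by
    rw [linearIndependent_iff']
    intro s g hg P hP
    choose r hr using fun P => Ideal.Quotient.mk_surjective (g P)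
    have hsum : ∑ P ∈ s, r P • v P ∈ M := by
      rw [← mem_smul_top_iff, ← Submodule.Quotient.mk_eq_zero, ← hg, ← Submodule.mkQ_apply,
        map_sum]
      refine Finset.sum_congr rfl fun P _ => ?_
      rw [← hr P, hmk, Submodule.mkQ_apply]
    by_contra hgP
    have hrm : r P ∉ m := fun h => hgP (by rw [← hr P]; exact Ideal.Quotient.eq_zero_iff_mem.2 h)
    have hrP : algebraMap R S (r P) ∉ P.1 := fun h => hrm <| by
      have : m ≤ P.1.comap (algebraMap R S) := Ideal.map_le_iff_le_comap.1 P.2.2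
      rw [hm.eq_of_le (Ideal.comap_ne_top _ P.2.1.ne_top) this]
      exact h
    -- `e` isolates the component at `P`
    obtain ⟨e, he, heP⟩ : ∃ e ∈ ∏ T ∈ s.erase P, T.1, e ∉ P.1 := by
      refine SetLike.not_le_iff_exists.1 fun hle => ?_
      obtain ⟨T, hT, hTP⟩ := (P.2.1.isPrime.prod_le).1 hle
      exact (Finset.ne_of_mem_erase hT) (Subtype.ext (T.2.1.eq_of_le P.2.1.ne_top hTP))
    have h1 : e * (r P • v P) ∈ M := by
      have h2 := M.mul_mem_left e hsum
      rw [← Finset.add_sum_erase s _ hP, mul_add] at h2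
      refine (Ideal.add_mem_iff_left M ?_).1 h2
      rw [Finset.mul_sum]
      refine sum_mem fun T hT => ?_
      have heT : e ∈ T.1 := (Ideal.prod_le_inf.trans (Finset.inf_le hT)) he
      rw [Algebra.smul_def, mul_left_comm]
      exact M.mul_mem_left _ (hPv T e heT)
    have h3 : e * algebraMap R S (r P) ∉ P.1 := fun h =>
      (P.2.1.isPrime.mem_or_mem h).elim heP hrP
    obtain ⟨y, i, hi, hyi⟩ := P.2.1.exists_inv h3
    refine hvM P ?_
    have : v P = y * (e * (r P • v P)) + i * v P := by
      rw [Algebra.smul_def]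
      linear_combination -(v P) * hyi
    rw [this]
    exact add_mem (M.mul_mem_left _ h1) (hPv P i hi)
  obtain ⟨φ, hφ⟩ := exists_linearMap_eq_one hli
  let N : Submodule R S :=
    { carrier := {x | φ (Submodule.Quotient.mk x) = 0}
      zero_mem' := by simp
      add_mem' := fun {x y} hx hy => by
        change φ (Submodule.Quotient.mk (x + y)) = 0
        rw [Submodule.Quotient.mk_add, map_add, hx, hy, add_zero]
      smul_mem' := fun r x hx => by
        change φ (Submodule.Quotient.mk (r • x)) = 0
        rw [← hmk, map_smul, hx, smul_zero] }
  have hN : ∀ x, x ∈ N ↔ φ (Submodule.Quotient.mk x) = 0 := fun x => Iff.rfl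
  have hMN : m • (⊤ : Submodule R S) ≤ N := fun x hx => by
    rw [hN, (Submodule.Quotient.mk_eq_zero _).2 hx, map_zero]
  have hvN : ∀ P, v P ∉ N := fun P h => by
    rw [hN, hφ] at h
    exact one_ne_zero h
  obtain ⟨P₀, hP₀, hle₀⟩ := Ideal.exists_le_maximal _ hmtop
  refine ⟨N, hMN, ⟨v ⟨P₀, hP₀, hle₀⟩, hvN _, fun x => ?_⟩, fun X hX => ?_⟩
  · obtain ⟨r, hr⟩ := Ideal.Quotient.mk_surjective (φ (Submodule.Quotient.mk x))
    refine ⟨r, ?_⟩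
    rw [hN, Submodule.Quotient.mk_sub, map_sub, ← hmk, map_smul, hφ, smul_eq_mul, mul_one, hr,
      sub_self]
  · -- an ideal that is strictly larger than `m S` contains some `Q P`, hence `v P`
    by_contra hcon
    obtain ⟨D, hD⟩ : X ⊔ M ∣ M := Ideal.dvd_iff_le.2 le_sup_right
    have hDtop : D ≠ ⊤ := by
      rintro rfl
      rw [Ideal.mul_top] at hD
      exact hcon (le_sup_left.trans hD.ge)
    obtain ⟨P, hP, hDP⟩ := Ideal.exists_le_maximal _ hDtop
    have hMP : M ≤ P := by
      rw [hD]
      exact Ideal.mul_le_right.trans hDP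
    obtain ⟨E, hE⟩ : P ∣ D := Ideal.dvd_iff_le.2 hDP
    have h1 : P * Q ⟨P, hP, hMP⟩ = P * ((X ⊔ M) * E) := by
      rw [← hQ ⟨P, hP, hMP⟩]
      conv_lhs => rw [hD, hE]
      ring
    have hP0 : P ≠ 0 := fun h => hm0 (le_bot_iff.1 (hMP.trans h.le))
    have h2 := mul_left_cancel₀ hP0 h1
    have h3 : v ⟨P, hP, hMP⟩ ∈ X ⊔ M := by
      have := hv ⟨P, hP, hMP⟩
      rw [h2] at this
      exact Ideal.mul_le_left this
    obtain ⟨x, hx, y, hy, hxy⟩ := Submodule.mem_sup.1 h3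
    refine hvN ⟨P, hP, hMP⟩ ?_
    rw [← hxy]
    exact add_mem (hX x hx) (hMN (mem_smul_top_iff.2 hy))

end

section StableGenerators

variable {R K : Type*} [CommRing R] [IsDomain R] [Field K] [Algebra R K] [IsFractionRing R K]

/-- For a maximal ideal `m` the ring `S / m S` has dimension at most two over `R / m`. Let `N` be
the colength-one module of `exists_colength_one` and `F` its ring of multipliers. Then
`F ⊆ R + m S`, and since `N` is invertible over `F` and `S / N` is simple, so is `S / F`. -/
theorem IsStableDomain.exists_le_span_pair (hs : IsStableDomain R K)
    (hc : completeConductor R K ≠ ⊥) {m : Ideal R} (hm : m.IsMaximal) (hm0 : m ≠ ⊥)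
    (hmtop : m.map (algebraMap R (completeIntegralClosure R K)) ≠ ⊤) :
    ∃ u : completeIntegralClosure R K,
      (⊤ : Submodule R (completeIntegralClosure R K)) ≤ span R {1, u} ⊔ m • ⊤ := by
  have hded := hs.isDedekindDomain hc
  have hinj : Function.Injective (algebraMap R (completeIntegralClosure R K)) :=
    FaithfulSMul.algebraMap_injective _ _
  obtain ⟨N, hmN, ⟨s₀, hs₀, hs₀'⟩, hN⟩ := exists_colength_one hm
    (fun h => hm0 ((Ideal.map_eq_bot_iff_of_injective hinj).1 h)) hmtop
  -- a module that properly contains `N` is all of `S`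
  have hcov : ∀ Y : Submodule R (completeIntegralClosure R K), N ≤ Y → ∀ y ∈ Y, y ∉ N → Y = ⊤ := by
    intro Y hNY y hy hyN
    obtain ⟨r, hr⟩ := hs₀' y
    have hrm : r ∉ m := fun h => hyN <| by
      have := add_mem hr (hmN (smul_mem_smul h (Submodule.mem_top (x := s₀))))
      rwa [sub_add_cancel] at this
    have hs₀Y : s₀ ∈ Y := by
      refine mem_of_smul_mem_of_notMem hm (hmN.trans hNY) (Submodule.mem_top) hrm ?_
      have := sub_mem hy (hNY hr)
      rwa [sub_sub_cancel] at this
    refine eq_top_iff.2 fun x _ => ?_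
    obtain ⟨q, hq⟩ := hs₀' x
    have := add_mem (hNY hq) (Y.smul_mem q hs₀Y)
    rwa [sub_add_cancel] at this
  -- the image in `K` of a submodule of `S`
  let ι : (completeIntegralClosure R K) →ₗ[R] K := (completeIntegralClosure R K).val.toLinearMap
  set S' : Submodule R K := Subalgebra.toSubmodule (completeIntegralClosure R K) with hS'
  set N' : Submodule R K := N.map ι with hN'
  have hmemN : ∀ x : completeIntegralClosure R K, (x : K) ∈ N' ↔ x ∈ N := by
    intro x
    constructor
    · rintro ⟨y, hy, hyx⟩
      rwa [← Subtype.ext (show (y : K) = x from hyx)]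
    · exact fun hx => ⟨x, hx, rfl⟩
  have hNS : N' ≤ S' := by
    rintro _ ⟨x, -, rfl⟩
    exact x.2
  have hcov' : ∀ Y : Submodule R K, N' ≤ Y → ¬ Y ≤ N' → Y ≤ S' → Y = S' := by
    intro Y hNY hYN hYS
    obtain ⟨y, hy, hyN⟩ := SetLike.not_le_iff_exists.1 hYN
    have htop := hcov (Y.comap ι) (map_le_iff_le_comap.1 hNY) ⟨y, hYS hy⟩ hy
      fun h => hyN ((hmemN _).2 h)
    refine le_antisymm hYS fun x hx => ?_
    have : (⟨x, hx⟩ : completeIntegralClosure R K) ∈ Y.comap ι := htop ▸ Submodule.mem_top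
    exact this
  have h1S : (1 : Submodule R K) ≤ S' :=
    Submodule.one_le.2 (completeIntegralClosure R K).one_mem
  have hSS : S' * S' = S' := le_antisymm
    (Submodule.mul_le.2 fun x hx y hy => (completeIntegralClosure R K).mul_mem hx hy)
    (by conv_lhs => rw [← one_mul S']
        exact mul_le_mul_left h1S _)
  by_cases hNmul : N' * S' ≤ N'
  · -- `N` is an ideal of `S`, so that `N = m S`
    refine ⟨s₀, fun x _ => ?_⟩
    obtain ⟨r, hr⟩ := hs₀' x
    have hX : Ideal.span {x - r • s₀} ≤ m.map (algebraMap R (completeIntegralClosure R K)) := by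
      refine hN _ fun y hy => ?_
      obtain ⟨t, rfl⟩ := Ideal.mem_span_singleton'.1 hy
      rw [← hmemN, mul_comm]
      exact hNmul (mul_mem_mul ((hmemN _).2 hr) t.2)
    refine mem_span_pair_sup_iff.2 ⟨0, r, x - r • s₀,
      mem_smul_top_iff.2 (hX (Ideal.mem_span_singleton_self _)), by simp⟩
  have hNmulS : N' * S' = S' := hcov' _
    (by conv_lhs => rw [← mul_one N']
        exact mul_le_mul_right h1S _) hNmul
    ((mul_le_mul_left hNS _).trans hSS.le)
  have hS0 : S' ≠ ⊥ := fun h => by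
    have : (1 : K) ∈ S' := Submodule.one_le.1 h1S
    rw [h] at this
    exact one_ne_zero ((Submodule.mem_bot R).1 this)
  have hN0 : N' ≠ ⊥ := fun h => hS0 (by rw [← hNmulS, h, Submodule.bot_mul])
  have hNf : IsFractional R⁰ N' :=
    isFractional_of_le hNS (isFractional_completeIntegralClosure hc)
  have hinv := (hs.isStableModule hN0 hNf).mul_eq
  set F := N' / N' with hF
  have hFS : F ≤ S' := div_self_le hN0 hNf
  have h1F : 1 ≤ F := one_le_div_self N'
  -- `F ⊆ R + m S`: if `a ≡ r` on the simple module `S / N`, then `(a - r) S ⊆ N`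
  have hFred : ∀ a : completeIntegralClosure R K, (a : K) ∈ F →
      ∃ r : R, ∃ n ∈ m.map (algebraMap R (completeIntegralClosure R K)),
        a = algebraMap R _ r + n := by
    intro a ha
    obtain ⟨r, hr⟩ := hs₀' (a * s₀)
    have hsub : ∀ n ∈ N, (a - algebraMap R _ r) * n ∈ N := by
      intro n hn
      rw [sub_mul, ← Algebra.smul_def]
      exact sub_mem ((hmemN _).1 (mul_mem_of_mem_div ha ((hmemN _).2 hn))) (N.smul_mem r hn)
    have hX : Ideal.span {a - algebraMap R _ r} ≤
        m.map (algebraMap R (completeIntegralClosure R K)) := by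
      refine hN _ fun y hy => ?_
      obtain ⟨t, rfl⟩ := Ideal.mem_span_singleton'.1 hy
      obtain ⟨q, hq⟩ := hs₀' t
      have : t * (a - algebraMap R _ r) = (a - algebraMap R _ r) * (t - q • s₀) +
          q • (a * s₀ - r • s₀) := by
        simp only [Algebra.smul_def]
        ring
      rw [this]
      exact add_mem (hsub _ hq) (N.smul_mem q hr)
    exact ⟨r, a - algebraMap R _ r, hX (Ideal.mem_span_singleton_self _), by ring⟩
  have hmF : ∀ n ∈ m.map (algebraMap R (completeIntegralClosure R K)), (n : K) ∈ F := by
    intro n hn x hx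
    obtain ⟨y, hy, rfl⟩ := hx
    exact (hmemN (n * y)).2 (hmN (mem_smul_top_iff.2 (Ideal.mul_mem_right _ _ hn)))
  by_cases hFtop : S' ≤ F
  · refine ⟨1, fun x _ => ?_⟩
    obtain ⟨r, n, hn, hx⟩ := hFred x (hFtop x.2)
    exact mem_span_pair_sup_iff.2 ⟨r, 0, n, mem_smul_top_iff.2 hn, by
      rw [hx, Algebra.smul_def]; simp⟩
  obtain ⟨u, hu, huF⟩ := SetLike.not_le_iff_exists.1 hFtop
  -- `X = F + R u` is an `F`-module, and `N X = S = N S` can be cancelled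
  set X : Submodule R K := F ⊔ span R {u} with hX
  have hXS : X ≤ S' := sup_le hFS ((span_singleton_le_iff_mem _ _).2 hu)
  have hFX : F * X ≤ X := by
    refine Submodule.mul_le.2 fun f hf x hx => ?_
    obtain ⟨r, n, hn, hfr⟩ := hFred ⟨f, hFS hf⟩ hf
    have hfr' : f = algebraMap R K r + n := congrArg Subtype.val hfr
    rw [hfr', add_mul, ← Algebra.smul_def]
    exact add_mem (X.smul_mem r hx)
      (mem_sup_left (hmF (n * ⟨x, hXS hx⟩) (Ideal.mul_mem_right _ _ hn)))
  have hNX : N' * X = S' := by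
    refine hcov' _ ?_ (fun hle => ?_)
      ((mul_le_mul_left hNS _).trans ((mul_le_mul_right hXS _).trans hSS.le))
    · conv_lhs => rw [← mul_one N']
      exact mul_le_mul_right (h1F.trans le_sup_left) _
    · have : X ≤ F := Submodule.le_div_iff_mul_le.2 (by rwa [mul_comm])
      exact huF (this (mem_sup_right (mem_span_singleton_self u)))
  have hFS' : F * S' = S' := le_antisymm ((mul_le_mul_left hFS _).trans hSS.le)
    (by conv_lhs => rw [← one_mul S']
        exact mul_le_mul_left h1F _)
  have hSX : S' ≤ X :=
    calc S' = F * S' := hFS'.symm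
      _ = F / N' * (N' * S') := by rw [← mul_assoc, mul_comm (F / N'), hinv]
      _ = F / N' * (N' * X) := by rw [hNmulS, hNX]
      _ = F * X := by rw [← mul_assoc, mul_comm (F / N'), hinv]
      _ ≤ X := hFX
  refine ⟨⟨u, hu⟩, fun x _ => ?_⟩
  obtain ⟨f, hf, w, hw, hfw⟩ := Submodule.mem_sup.1 (hSX x.2)
  obtain ⟨q, rfl⟩ := mem_span_singleton.1 hw
  obtain ⟨r, n, hn, hfr⟩ := hFred ⟨f, hFS hf⟩ hf
  have hfr' : f = algebraMap R K r + n := congrArg Subtype.val hfr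
  refine mem_span_pair_sup_iff.2 ⟨r, q, n, mem_smul_top_iff.2 hn, Subtype.ext ?_⟩
  rw [← hfw, hfr']
  simp only [Algebra.smul_def, mul_one]
  change _ = algebraMap R K r + algebraMap R K q * u + n
  ring

/-- A stable domain with non-zero conductor that is weakly Krull or Mori has `2`-generated
ideals. -/
theorem IsStableDomain.allIdealsTwoGenerated (hs : IsStableDomain R K)
    (hc : completeConductor R K ≠ ⊥) (hR : IsWeaklyKrull R K ∨ IsMori R K) :
    AllIdealsTwoGenerated R := by
  have hded := hs.isDedekindDomain hc
  obtain ⟨c, hc0, hcS⟩ := exists_ne_zero_mul_mem hc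
  have hmax : ∀ P : Ideal (completeIntegralClosure R K), P.IsPrime → P ≠ ⊥ →
      (P.comap (algebraMap R (completeIntegralClosure R K))).IsMaximal :=
    fun P hP hP0 => isMaximal_comap hs hc hR hP hP0
  have hcS' : ∀ σ : completeIntegralClosure R K, ∃ r : R,
      algebraMap R (completeIntegralClosure R K) r = algebraMap R _ c * σ := fun σ => by
    obtain ⟨r, hr⟩ := hcS σ σ.2
    exact ⟨r, Subtype.ext hr⟩
  exact allIdealsTwoGenerated_of_forall_isMaximal hmax hc0 hcS' fun m hm hm0 =>
    hs.exists_le_span_pair hc hm hm0 (map_ne_top hmax hc0 hcS' hm)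

end StableGenerators

end StableDomain


open StableDomain in
theorem theorem3p7 (R : Type*) [CommRing R] [IsDomain R]
    (K : Type*) [Field K] [Algebra R K] [IsFractionRing R K]
    (hcond : StableDomain.completeConductor R K ≠ ⊥)
    (hR : StableDomain.IsWeaklyKrull R K ∨ StableDomain.IsMori R K) :
    (StableDomain.IsStableDomain R K ↔ StableDomain.AllIdealsTwoGenerated R) ∧
    (StableDomain.IsStableDomain R K → StableDomain.IsOrderInDedekindDomain R K) := by
  refine ⟨⟨fun hs => hs.allIdealsTwoGenerated hcond hR, fun h => h.isStableDomain⟩, fun hs => ?_⟩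
  refine ⟨completeIntegralClosure R K, hs.isDedekindDomain hcond, inferInstance, ?_⟩
  -- the complete integral closure is a fractional ideal, hence `2`-generated
  obtain ⟨a, -, b, -, hab⟩ := exists_eq_span_pair (hs.allIdealsTwoGenerated hcond hR)
    (isFractional_completeIntegralClosure hcond)
  refine Module.Finite.iff_fg.2 (?_ : (Subalgebra.toSubmodule (completeIntegralClosure R K)).FG)
  rw [hab]
  exact Submodule.fg_span (by simp)
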